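/- **Setting.** Let $\alpha>2$, $\beta>0$, $\varepsilon>0$, $0<p\le\frac12$ be constants, and let $n$ nodes be placed at points of the Euclidean plane with pairwise distances at least $1$; let $d(u,v)$ be the distance of nodes $u,v$, let $\Delta$ be the maximum distance between two nodes, and put $\Upsilon=\max\{\log\log\Delta,0\}+\log n$ (with $\log\log\Delta$ read as $0$ if $\Delta\le e$). A *link* $\ell=(u,v)$ is an ordered pair of nodes (sender $u$, receiver $v$), of length $d(u,v)$. If exactly the nodes of a set $S$ transmit, $w$ with power $P_w$, then a node $v\notin S$ *receives* the message of $u\in S$ iff $\frac{P_u/d(u,v)^\alpha}{N+\sum_{w\in S\setminus\{u\}}P_w/d(w,v)^\alpha}\ge\beta$, where $N>0$ is the noise. **The tree $\mathcal T$.** Let $A$ be a set of nodes. All nodes of $A$ are initially active. There are $R\ge\lceil\log_2\Delta\rceil$ rounds, each of $\lceil\lambda\log n\rceil$ slot-pairs. In a slot-pair of round $r$ all transmissions use power $2\beta N2^{r\alpha}$, and: (1) each active node independently becomes a broadcaster with probability $p$ and otherwise a listener; the broadcasters transmit; (2) each listener $v$ that received a message from a broadcaster $u$ with $2^{r-1}\le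 d(u,v)<2^r$ transmits, independently with probability $p$, an acknowledgment addressed to $u$; each broadcaster $u$ that receives an acknowledgment addressed to it, from $v$ say, forms the link $(u,v)$ and becomes inactive. (If $\beta<1$ and several such messages are received at once, one is chosen by an arbitrary fixed rule.) $\mathcal T$ is the set of all links formed, $M$ is the set of nodes incident to at most $160/p^2$ links of $\mathcal T$, and $\mathcal T(M)$ is the set of links of $\mathcal T$ with both endpoints in $M$. **Affectance.** Under mean power the sender of $\ell=(u,v)$ uses power $P_u=K\,d(u,v)^{\alpha/2}$, where $K>0$ is a common scaling factor (for instance $K=1$). Put $c(u,v)=\beta/(1-\beta N d(u,v)^\alpha/P_u)$; it is assumed that for all distinct nodes $u,v\in A$ one has $\beta N d(u,v)^\alpha/P_u<1$ and $c(u,v)\le 2\beta$. The affectance on $\ell=(u,v)$ from a sender $w$ is $$a^{\mathcal M}_w(\ell)=\min\Bigl\{1+\varepsilon,\ c(u,v)\,\frac{P_w}{P_u}\Bigl(\frac{d(u,v)}{d(w,v)}\Bigr)^{\alpha}\Bigr\},$$ which is $1+\varepsilon$ if $w=v$. For a link set $L$ in which every node is the sender of at most one link, with set of senders $S(L)$,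 put $a^{\mathcal M}_L(L)=\sum_{\ell\in L}\sum_{w\in S(L)}a^{\mathcal M}_w(\ell)$. **Lemma.** There is a constant $\gamma_1>0$, depending only on $\alpha,\beta,\varepsilon,p$, such that for every $c>0$ there is a $\lambda_0$, depending only on $\alpha,\beta,\varepsilon,p,c$, such that for all $\lambda\ge\lambda_0$ and all choices of the remaining data ($n$, the points, $N$, $K$, $A$, $R$, the choice rule) as above, with probability at least $1-n^{-c}$, $$a^{\mathcal M}_{\mathcal T(M)}(\mathcal T(M))\ \le\ \gamma_1\,\Upsilon\,|\mathcal T(M)| .$$ -/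

import Mathlib

open MeasureTheory ProbabilityTheory

noncomputable section

namespace SINR

/-- The Euclidean plane. -/
abbrev Plane : Type := EuclideanSpace ℝ (Fin 2)

/-- A link `(u, v)` between two of `n` nodes, with sender `u` and receiver `v`. -/
abbrev Link (n : ℕ) : Type := Fin n × Fin n

variable {n : ℕ}

/-- The length `d(u, v)` of the link `(u, v)`, for nodes placed at the points `x 0, …, x (n-1)`. -/
def len (x : Fin n → Plane) (l : Link n) : ℝ := dist (x l.1) (x l.2)

/-- The maximum distance `Δ` between two nodes. -/
def maxDist (x : Fin n → Plane) : ℝ := Metric.diam (Set.range x)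

/-- `Υ = log log Δ + log n`, where the double logarithm is read as `0` when `Δ ≤ e`. -/
def upsilon (x : Fin n → Plane) : ℝ :=
  max (Real.log (Real.log (maxDist x))) 0 + Real.log n

/-! ### Successful reception -/

/-- The receiver `v` decodes the message of `u ∈ S` when exactly the nodes of `S` transmit, all of
them with power `P`: the signal-to-interference-and-noise ratio at `v` is at least `β`. -/
def Received (α β N : ℝ) (x : Fin n → Plane) (P : ℝ) (S : Finset (Fin n)) (u v : Fin n) : Prop :=
  u ∈ S ∧ v ∉ S ∧
    β ≤ (P / dist (x u) (x v) ^ α) / (N + ∑ w ∈ S.erase u, P / dist (x w) (x v) ^ α)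

/-! ### The tree construction `Init` -/

/-- The power used by all transmitters in round `r`. -/
def roundPower (α β N : ℝ) (r : ℕ) : ℝ := 2 * β * N * (2 : ℝ) ^ ((r : ℝ) * α)

/-- The state of `Init`: the active nodes, and the links `(u, v)`, directed from child to parent,
that have been successfully formed so far. -/
structure State (n : ℕ) where
  active : Finset (Fin n)
  links : Finset (Link n)

/-- The active nodes that broadcast in the first slot of a slot-pair; `b u` is the outcome of the
broadcast coin of `u`. The other active nodes listen. -/
def broadcasters (b : Fin n → Bool) (A : Finset (Fin n)) : Finset (Fin n) :=
  A.filter fun u => b u = true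

open Classical in
/-- The broadcasters `u` with `2 ^ (r - 1) ≤ d(u, v) < 2 ^ r` whose message `v` decodes in the first
slot of a slot-pair of round `r`. -/
def heard (α β N : ℝ) (x : Fin n → Plane) (r : ℕ) (b : Fin n → Bool) (A : Finset (Fin n))
    (v : Fin n) : Finset (Fin n) :=
  (broadcasters b A).filter fun u =>
    Received α β N x (roundPower α β N r) (broadcasters b A) u v ∧
      (2 : ℝ) ^ ((r : ℝ) - 1) ≤ dist (x u) (x v) ∧ dist (x u) (x v) < (2 : ℝ) ^ (r : ℝ)

open Classical in
/-- The listeners that transmit an acknowledgment in the second slot: those that have heard a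
broadcast in the right distance range and whose acknowledgment coin `a v` came up. -/
def ackers (α β N : ℝ) (x : Fin n → Plane) (r : ℕ) (b a : Fin n → Bool) (A : Finset (Fin n)) :
    Finset (Fin n) :=
  A.filter fun v => b v = false ∧ a v = true ∧ (heard α β N x r b A v).Nonempty

open Classical in
/-- The nodes `v` whose acknowledgment is addressed to `u` and decoded by `u` in the second slot.
A listener `v` addresses its acknowledgment to the broadcaster `sel (heard … v)`; the rule `sel`
picks one element of a set and matters only if several messages can be decoded at once
(impossible when `1 ≤ β`). -/
def acksReceived (α β N : ℝ) (x : Fin n → Plane) (sel : Finset (Fin n) → Fin n) (r : ℕ)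
    (b a : Fin n → Bool) (A : Finset (Fin n)) (u : Fin n) : Finset (Fin n) :=
  (ackers α β N x r b a A).filter fun v =>
    sel (heard α β N x r b A v) = u ∧
      Received α β N x (roundPower α β N r) (ackers α β N x r b a A) v u

open Classical in
/-- The broadcasters that receive an acknowledgment. -/
def acknowledged (α β N : ℝ) (x : Fin n → Plane) (sel : Finset (Fin n) → Fin n) (r : ℕ)
    (b a : Fin n → Bool) (A : Finset (Fin n)) : Finset (Fin n) :=
  (broadcasters b A).filter fun u => (acksReceived α β N x sel r b a A u).Nonempty

open Classical in
/-- One slot-pair of round `r`: every acknowledged broadcaster `u` forms a link to its acknowledger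
and becomes inactive. -/
def slotPair (α β N : ℝ) (x : Fin n → Plane) (sel : Finset (Fin n) → Fin n) (r : ℕ)
    (b a : Fin n → Bool) (s : State n) : State n where
  active := s.active \ acknowledged α β N x sel r b a s.active
  links := s.links ∪ (acknowledged α β N x sel r b a s.active).image fun u =>
    (u, sel (acksReceived α β N x sel r b a s.active u))

/-- The state of `Init` after `t` slot-pairs, started with the active nodes `A`, when each round
consists of `m` slot-pairs. In slot-pair `t` (counted from `0`, hence in round `t / m + 1`),
`coin (t, u, false)` and `coin (t, u, true)` are the broadcast and acknowledgment coins of `u`. -/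
def initState (α β N : ℝ) (x : Fin n → Plane) (sel : Finset (Fin n) → Fin n) (m : ℕ)
    (A : Finset (Fin n)) (coin : ℕ × Fin n × Bool → Bool) : ℕ → State n
  | 0 => ⟨A, ∅⟩
  | t + 1 => slotPair α β N x sel (t / m + 1) (fun u => coin (t, u, false))
      (fun u => coin (t, u, true)) (initState α β N x sel m A coin t)

/-- The number `⌈lam * log n⌉` of slot-pairs in a round. -/
def pairsPerRound (lam : ℝ) (n : ℕ) : ℕ := ⌈lam * Real.log n⌉₊

/-- The aggregation tree `𝒯` produced by `R` rounds of `Init` on the nodes of `A`. -/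
def initTree (α β N lam : ℝ) (x : Fin n → Plane) (sel : Finset (Fin n) → Fin n) (R : ℕ)
    (A : Finset (Fin n)) (coin : ℕ × Fin n × Bool → Bool) : Finset (Link n) :=
  (initState α β N x sel (pairsPerRound lam n) A coin (R * pairsPerRound lam n)).links

/-- The degree of `u` in a link set: the number of links incident on `u`. -/
def degree (T : Finset (Link n)) (u : Fin n) : ℕ := (T.filter fun l => l.1 = u ∨ l.2 = u).card

open Classical in
/-- For a link set `𝒯`, the links induced by the set `M` of nodes of degree at most `D` in `𝒯`. -/
def lowDegreeLinks (D : ℝ) (T : Finset (Link n)) : Finset (Link n) :=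
  T.filter fun l => (degree T l.1 : ℝ) ≤ D ∧ (degree T l.2 : ℝ) ≤ D

/-- The coins are independent and each is heads (`true`) with probability `p`. -/
structure IsIIDCoins {Ω : Type*} [MeasurableSpace Ω] (μ : Measure Ω) {ι : Type*} (p : ℝ)
    (coin : ι → Ω → Bool) : Prop where
  measurable : ∀ i, Measurable (coin i)
  indep : iIndepFun coin μ
  prob : ∀ i, μ.real {ω | coin i ω = true} = p

/-! ### Affectance -/

/-- The mean power assignment, with a common scaling factor `K`. -/
def meanPower (α K : ℝ) (x : Fin n → Plane) (l : Link n) : ℝ := K * len x l ^ (α / 2)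

/-- The fraction `β N d(u, v) ^ α / P_u` of the tolerable disturbance that noise uses up. -/
def noiseLoad (α β N : ℝ) (x : Fin n → Plane) (P : Link n → ℝ) (l : Link n) : ℝ :=
  β * N * len x l ^ α / P l

/-- The factor `c(u, v) = β / (1 - β N d(u, v) ^ α / P_u)`. -/
def noiseFactor (α β N : ℝ) (x : Fin n → Plane) (P : Link n → ℝ) (l : Link n) : ℝ :=
  β / (1 - noiseLoad α β N x P l)

open Classical in
/-- The affectance of the sender of `l'` on the link `l` under the power assignment `P`, thresholded
at `1 + ε`. If the sender of `l'` is the receiver of `l`, then the distance in the denominator is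
`0`, and the affectance is `1 + ε`. -/
def affectance (α β N ε : ℝ) (x : Fin n → Plane) (P : Link n → ℝ) (l' l : Link n) : ℝ :=
  if dist (x l'.1) (x l.2) = 0 then 1 + ε
  else min (1 + ε)
    (noiseFactor α β N x P l * (P l' / P l) * (len x l / dist (x l'.1) (x l.2)) ^ α)

/-- The total affectance `a_L(L)` within a link set in which each node sends on at most one link. -/
def totalAffectance (α β N ε : ℝ) (x : Fin n → Plane) (P : Link n → ℝ) (L : Finset (Link n)) : ℝ :=
  ∑ l ∈ L, ∑ l' ∈ L, affectance α β N ε x P l' l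

end SINR

end

/-! The proof separates a random event from a deterministic estimate. The event is `RoundsSpread`:
after every round, surviving active nodes lie far apart on the scale of that round.

Probability. Suppose the active nodes are spread at the start of round `r` and `u`, `v` are active
with distance in `[2 ^ (r - 1), 2 ^ r)`. By packing, boundedly many active nodes lie within a
constant multiple of `2 ^ r` of them, and since `α > 2` all others together interfere by at most the
noise. So with constant probability per slot-pair the nearby coins let exactly `u` broadcast and `v`
acknowledge, and `u` drops out (`mem_acknowledged_of_quiet`). The pair survives its round with
probability at most `(1 - q) ^ m`. Each pair has only one critical round, so a union bound over at
most `n ^ 2` pairs suffices, with no dependence on `Δ` (`one_sub_le_measureReal_roundsSpread`).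

Geometry. On the event, give each link the round `s` of its formation as scale. Endpoints of links
of scale at least `s` that are distinct nodes are then at distance at least `2 ^ s / 2`, and low
degree bounds how many links share a node. Mean power makes the affectance bound symmetric in the
two lengths (`affectance_le_pairBound`), so each ordered pair can be charged to its shorter link. It
remains to bound what one link of scale `r` gets from the longer ones (`sum_pairBound_le`). Far
links contribute `O(1)`, by packing and decay in the scale gap. Links whose interaction is below
about `n ^ (-2)` contribute `O(1)`, as there are at most `n ^ 2` links. The remaining links are near
and significant. Among them, `O(log n)` small scale gaps cost a bounded number each; beyond these,
significance forces such strong proximity that a whole window of gaps, of doubling width, shares one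
endpoint, and `O(log log Δ)` windows exhaust all scales (`card_near_le`). -/

namespace SINR

/-! ### Packing in the plane -/

/-- A `σ`-separated set of points in a disc of radius `ρ` has at most `(2 ρ / σ + 1) ^ 2` points. -/
theorem card_le_of_separated {s : Finset Plane} {σ ρ : ℝ} (hσ : 0 < σ) (hρ : 0 ≤ ρ) (y : Plane)
    (hsep : ∀ a ∈ s, ∀ b ∈ s, a ≠ b → σ ≤ dist a b) (hs : ∀ a ∈ s, dist a y ≤ ρ) :
    (s.card : ℝ) ≤ (2 * ρ / σ + 1) ^ 2 := by
  have hd : Set.PairwiseDisjoint (s : Set Plane) fun a => Metric.ball a (σ / 2) := by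
    intro a ha b hb hab
    exact Metric.ball_disjoint_ball (by linarith [hsep a ha b hb hab])
  have hsub : (⋃ a ∈ s, Metric.ball a (σ / 2)) ⊆ Metric.ball y (ρ + σ / 2) := by
    refine Set.iUnion₂_subset fun a ha => Metric.ball_subset_ball' ?_
    linarith [hs a ha]
  have hball : ∀ (a : Plane) {r : ℝ}, 0 < r → (volume : Measure Plane).real (Metric.ball a r) =
      r ^ 2 * (volume : Measure Plane).real (Metric.ball 0 1) := by
    intro a r hr
    rw [measureReal_def, Measure.addHaar_ball_of_pos _ _ hr, ENNReal.toReal_mul,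
      ENNReal.toReal_ofReal (by positivity), measureReal_def]
    simp
  have hpos : 0 < (volume : Measure Plane).real (Metric.ball 0 1) :=
    ENNReal.toReal_pos (Metric.measure_ball_pos _ _ zero_lt_one).ne' measure_ball_lt_top.ne
  have hle : (volume : Measure Plane).real (⋃ a ∈ s, Metric.ball a (σ / 2)) ≤
      (volume : Measure Plane).real (Metric.ball y (ρ + σ / 2)) :=
    measureReal_mono hsub measure_ball_lt_top.ne
  rw [measureReal_biUnion_finset hd (fun _ _ => measurableSet_ball)
    (fun _ _ => measure_ball_lt_top.ne), hball y (by positivity),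
    Finset.sum_congr rfl fun a _ => hball a (half_pos hσ), Finset.sum_const, nsmul_eq_mul,
    ← mul_assoc] at hle
  have h := le_of_mul_le_mul_right hle hpos
  have : (2 * ρ / σ + 1) ^ 2 = (ρ + σ / 2) ^ 2 / (σ / 2) ^ 2 := by
    field_simp
  rw [this, le_div_iff₀ (by positivity)]
  exact h

/-- The constant in the estimate of the interference from far away. -/
noncomputable def farConst (α : ℝ) : ℝ := 36 / (1 - (2 : ℝ) ^ (2 - α))

theorem two_rpow_lt_one {α : ℝ} (hα : 2 < α) : (2 : ℝ) ^ (2 - α) < 1 :=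
  Real.rpow_lt_one_of_one_lt_of_neg one_lt_two (by linarith)

theorem farConst_pos {α : ℝ} (hα : 2 < α) : 0 < farConst α :=
  div_pos (by norm_num) (by linarith [two_rpow_lt_one hα])

/-- The total path loss from a `σ`-separated set of points at distance at least `ρ`. -/
theorem sum_div_dist_rpow_le {α : ℝ} (hα : 2 < α) {s : Finset Plane} {σ ρ : ℝ} (hσ : 0 < σ)
    (hρ : σ ≤ 2 * ρ) (y : Plane) (hsep : ∀ a ∈ s, ∀ b ∈ s, a ≠ b → σ ≤ dist a b)
    (hs : ∀ a ∈ s, ρ ≤ dist a y) :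
    ∑ a ∈ s, (σ / dist a y) ^ α ≤ farConst α * (ρ / σ) ^ (2 - α) := by
  classical
  have hρ0 : 0 < ρ := by linarith
  set q : ℝ := (2 : ℝ) ^ (2 - α) with hq
  have hq0 : 0 < q := by positivity
  have hq1 : q < 1 := two_rpow_lt_one hα
  have hex : ∀ a : Plane, ∃ j : ℕ, a ∈ s → (2 : ℝ) ^ j * ρ ≤ dist a y ∧
      dist a y < (2 : ℝ) ^ (j + 1) * ρ := by
    intro a
    by_cases ha : a ∈ s
    · obtain ⟨j, hj, hj'⟩ := exists_nat_pow_near (x := dist a y / ρ) (y := (2 : ℝ))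
        ((one_le_div hρ0).2 (hs a ha)) one_lt_two
      exact ⟨j, fun _ => ⟨(le_div_iff₀ hρ0).1 hj, (div_lt_iff₀ hρ0).1 hj'⟩⟩
    · exact ⟨0, fun h => absurd h ha⟩
  choose j hj using hex
  -- Dyadic annuli: the number of points grows like `4 ^ k` while each term decays like `2 ^ (-k
  -- α)`, which leaves the ratio `q = 2 ^ (2 - α) < 1`.
  have hfib : ∀ k : ℕ, ∑ a ∈ s with j a = k, (σ / dist a y) ^ α ≤
      36 * (ρ / σ) ^ (2 - α) * q ^ k := by
    intro k
    have hterm : ∀ a ∈ s.filter (fun a => j a = k),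
        (σ / dist a y) ^ α ≤ (2 ^ k * (ρ / σ)) ^ (-α) := by
      intro a ha
      rw [Finset.mem_filter] at ha
      have h1 := (hj a ha.1).1
      rw [ha.2] at h1
      have h2 : (0 : ℝ) < 2 ^ k * ρ := by positivity
      rw [Real.rpow_neg (by positivity), ← Real.inv_rpow (by positivity)]
      refine Real.rpow_le_rpow (by positivity) ?_ (by linarith)
      rw [← mul_div_assoc, inv_div]
      gcongr
    have hcard : ((s.filter (fun a => j a = k)).card : ℝ) ≤ 36 * (2 ^ k * (ρ / σ)) ^ 2 := by
      have h := card_le_of_separated (s := s.filter (fun a => j a = k)) hσ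
        (ρ := 2 ^ (k + 1) * ρ) (by positivity) y
        (fun a ha b hb => hsep a (Finset.mem_filter.1 ha).1 b (Finset.mem_filter.1 hb).1)
        (fun a ha => by
          rw [Finset.mem_filter] at ha
          have := (hj a ha.1).2
          rw [ha.2] at this
          exact this.le)
      have h1 : 1 ≤ 2 * (2 ^ k * (ρ / σ)) := by
        have h2 : (1 : ℝ) ≤ 2 ^ k := one_le_pow₀ one_le_two
        have h3 : 1 ≤ 2 * ρ / σ := (one_le_div hσ).2 hρ
        have h4 : 2 * (2 ^ k * (ρ / σ)) = 2 ^ k * (2 * ρ / σ) := by ring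
        rw [h4]
        nlinarith
      -- The assumption `σ ≤ 2 * ρ` absorbs the summand `1` at the price of 2, so 4 becomes 6; its
      -- square is the 36 in `farConst`.
      have h2 : 2 * (2 ^ (k + 1) * ρ) / σ + 1 ≤ 6 * (2 ^ k * (ρ / σ)) := by
        have : 2 * (2 ^ (k + 1) * ρ) / σ = 4 * (2 ^ k * (ρ / σ)) := by ring
        linarith
      calc _ ≤ _ := h
        _ ≤ (6 * (2 ^ k * (ρ / σ))) ^ 2 := by gcongr
        _ = _ := by ring
    have hsplit : (2 ^ k * (ρ / σ)) ^ 2 * (2 ^ k * (ρ / σ)) ^ (-α) = (ρ / σ) ^ (2 - α) * q ^ k := by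
      have h0 : 0 < 2 ^ k * (ρ / σ) := by positivity
      rw [← Real.rpow_natCast _ 2, ← Real.rpow_add h0, Real.mul_rpow (by positivity) (by positivity),
        mul_comm, hq, ← Real.rpow_natCast 2 k, ← Real.rpow_mul two_pos.le,
        ← Real.rpow_natCast ((2 : ℝ) ^ (2 - α)) k, ← Real.rpow_mul two_pos.le]
      push_cast
      rw [← sub_eq_add_neg, mul_comm (k : ℝ)]
    calc _ ≤ (s.filter (fun a => j a = k)).card • ((2 ^ k * (ρ / σ)) ^ (-α)) :=
          Finset.sum_le_card_nsmul _ _ _ hterm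
      _ ≤ 36 * (2 ^ k * (ρ / σ)) ^ 2 * (2 ^ k * (ρ / σ)) ^ (-α) := by
          rw [nsmul_eq_mul]
          gcongr
      _ = _ := by rw [mul_assoc, hsplit, mul_assoc]
  rw [← Finset.sum_fiberwise_of_maps_to (s := s) (t := s.image j)
    (fun a ha => Finset.mem_image_of_mem j ha)]
  calc _ ≤ ∑ k ∈ s.image j, 36 * (ρ / σ) ^ (2 - α) * q ^ k := Finset.sum_le_sum fun k _ => hfib k
    _ = 36 * (ρ / σ) ^ (2 - α) * ∑ k ∈ s.image j, q ^ k := by rw [Finset.mul_sum]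
    _ ≤ 36 * (ρ / σ) ^ (2 - α) * (1 - q)⁻¹ := by
        gcongr
        exact sum_le_hasSum _ (fun _ _ => by positivity) (hasSum_geometric_of_lt_one hq0.le hq1)
    _ = _ := by rw [farConst]; ring

end SINR

namespace SINR

/-! ### Affectance from longer links of a sparse family -/

open Classical in
/-- A bound for the affectance under mean power between two links whose lengths have product at most
`2 ^ k`, when the sender of one has distance `D` from the receiver of the other. -/
noncomputable def pairBound (α β ε : ℝ) (k : ℕ) (D : ℝ) : ℝ :=
  if D = 0 then 1 + ε else min (1 + ε) (2 * β * ((2 : ℝ) ^ k) ^ (α / 2) / D ^ α)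

theorem pairBound_le_one_add (α β ε : ℝ) (k : ℕ) (D : ℝ) : pairBound α β ε k D ≤ 1 + ε := by
  unfold pairBound
  split_ifs
  · exact le_rfl
  · exact min_le_left _ _

theorem pairBound_le_of_pos (α β ε : ℝ) (k : ℕ) {D : ℝ} (hD : 0 < D) :
    pairBound α β ε k D ≤ 2 * β * ((2 : ℝ) ^ k) ^ (α / 2) / D ^ α := by
  unfold pairBound
  rw [if_neg hD.ne']
  exact min_le_right _ _

variable {ι : Type*}

/-- Points of a family separated on the scale `2 ^ s` that are close together on that scale
coincide, so that the family is no larger than the maximum multiplicity. -/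
theorem card_le_of_cluster {L : Finset ι} {s : ι → ℕ} {e : ι → Plane} {ψ : ℝ} (hψ : 0 ≤ ψ)
    (hsep : ∀ a ∈ L, ∀ b ∈ L, s a ≤ s b → e a ≠ e b → (2 : ℝ) ^ s a ≤ 2 * dist (e a) (e b))
    (hdeg : ∀ z, ((L.filter fun a => e a = z).card : ℝ) ≤ ψ) (y : Plane) (ρ : ℝ)
    {L' : Finset ι} (hL' : L' ⊆ L) (hy : ∀ a ∈ L', dist (e a) y < ρ)
    (hρ : ∀ a ∈ L', 4 * ρ ≤ (2 : ℝ) ^ s a) : (L'.card : ℝ) ≤ ψ := by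
  classical
  rcases L'.eq_empty_or_nonempty with rfl | ⟨a, ha⟩
  · simpa using hψ
  refine le_trans ?_ (hdeg (e a))
  have hlt : ∀ b ∈ L', ∀ c ∈ L', s b ≤ s c → e b = e c := by
    intro b hb c hc hbc
    by_contra hne
    have h1 := hsep b (hL' hb) c (hL' hc) hbc hne
    have h2 := dist_triangle_right (e b) (e c) y
    linarith [hy b hb, hy c hc, hρ b hb]
  have hsub : L' ⊆ L.filter fun b => e b = e a := by
    intro b hb
    refine Finset.mem_filter.2 ⟨hL' hb, ?_⟩
    rcases le_total (s a) (s b) with h | h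
    · exact (hlt a ha b hb h).symm
    · exact hlt b hb a ha h
  exact_mod_cast Finset.card_le_card hsub

/-- Total contribution of the members of a sparse family that are far away relative to their scale. -/
theorem sum_far_le {α β : ℝ} (hα : 2 < α) (hβ : 0 < β) {L : Finset ι} {s : ι → ℕ} {e : ι → Plane}
    {ψ : ℝ} (hψ : 0 ≤ ψ)
    (hsep : ∀ a ∈ L, ∀ b ∈ L, s a ≤ s b → e a ≠ e b → (2 : ℝ) ^ s a ≤ 2 * dist (e a) (e b))
    (hdeg : ∀ z, ((L.filter fun a => e a = z).card : ℝ) ≤ ψ) (y : Plane) {r : ℕ}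
    (hr : ∀ a ∈ L, r ≤ s a) (hfar : ∀ a ∈ L, (2 : ℝ) ^ s a ≤ 4 * dist (e a) y) :
    ∑ a ∈ L, 2 * β * ((2 : ℝ) ^ (r + s a)) ^ (α / 2) / dist (e a) y ^ α ≤
      4 * β * 2 ^ α * ψ * (farConst α * (1 / 2) ^ (2 - α)) := by
  classical
  have hC : 0 < farConst α := farConst_pos hα
  -- Group by the scale gap `k`. Relative to the separation scale `2 ^ (r + k)`, mean power weakens
  -- the interaction by `2 ^ (-k α / 2) ≤ 2 ^ (-k)`, so the gaps form a convergent geometric series.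
  have hfib : ∀ k : ℕ, ∑ a ∈ L with s a - r = k,
      2 * β * ((2 : ℝ) ^ (r + s a)) ^ (α / 2) / dist (e a) y ^ α ≤
        2 * β * 2 ^ α * ψ * (farConst α * (1 / 2) ^ (2 - α)) * (1 / 2) ^ k := by
    intro k
    set F := L.filter fun a => s a - r = k with hF
    have hs : ∀ a ∈ F, s a = r + k := by
      intro a ha
      rw [hF, Finset.mem_filter] at ha
      have := hr a ha.1
      omega
    have hmem : ∀ a ∈ F, a ∈ L := fun a ha => (Finset.mem_filter.1 ha).1
    have hhalf : ((2 : ℝ) ^ k) ^ (-(α / 2)) ≤ (1 / 2) ^ k := by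
      rw [Real.rpow_neg (by positivity), one_div, inv_pow]
      gcongr
      nth_rewrite 1 [← Real.rpow_one ((2 : ℝ) ^ k)]
      exact Real.rpow_le_rpow_of_exponent_le (one_le_pow₀ one_le_two) (by linarith)
    have hterm : ∀ a ∈ F, 2 * β * ((2 : ℝ) ^ (r + s a)) ^ (α / 2) / dist (e a) y ^ α ≤
        2 * β * 2 ^ α * (1 / 2) ^ k * (2 ^ (r + k) / 2 / dist (e a) y) ^ α := by
      intro a ha
      have hD : 0 < dist (e a) y := by
        have h1 := hfar a (hmem a ha)
        have h2 : (0 : ℝ) < 2 ^ s a := by positivity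
        linarith
      have h1 : ((2 : ℝ) ^ (r + s a)) ^ (α / 2) =
          ((2 : ℝ) ^ k) ^ (-(α / 2)) * ((2 : ℝ) ^ (r + k)) ^ α := by
        rw [hs a ha, ← Real.rpow_natCast 2, ← Real.rpow_natCast 2, ← Real.rpow_natCast 2,
          ← Real.rpow_mul two_pos.le, ← Real.rpow_mul two_pos.le, ← Real.rpow_mul two_pos.le,
          ← Real.rpow_add two_pos]
        congr 1
        push_cast
        ring
      have h2 : (2 ^ (r + k) / 2 / dist (e a) y) ^ α =
          ((2 : ℝ) ^ (r + k)) ^ α / 2 ^ α / dist (e a) y ^ α := by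
        rw [Real.div_rpow (by positivity) hD.le, Real.div_rpow (by positivity) two_pos.le]
      rw [h1, h2]
      have h3 : 2 * β * 2 ^ α * (1 / 2) ^ k *
          (((2 : ℝ) ^ (r + k)) ^ α / 2 ^ α / dist (e a) y ^ α) =
          2 * β * ((1 / 2) ^ k * ((2 : ℝ) ^ (r + k)) ^ α) / dist (e a) y ^ α := by
        have : (2 : ℝ) ^ α ≠ 0 := by positivity
        field_simp
      rw [h3]
      gcongr
    have hpts : ∑ a ∈ F, (2 ^ (r + k) / 2 / dist (e a) y) ^ α ≤
        ψ * (farConst α * (1 / 2) ^ (2 - α)) := by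
      rw [← Finset.sum_fiberwise_of_maps_to (s := F) (t := F.image e)
        (fun a ha => Finset.mem_image_of_mem e ha)]
      calc _ ≤ ∑ z ∈ F.image e, ψ * (2 ^ (r + k) / 2 / dist z y) ^ α := by
            refine Finset.sum_le_sum fun z _ => ?_
            rw [Finset.sum_congr rfl (g := fun _ => (2 ^ (r + k) / 2 / dist z y) ^ α)
              (fun a ha => by rw [(Finset.mem_filter.1 ha).2]), Finset.sum_const, nsmul_eq_mul]
            gcongr
            refine le_trans ?_ (hdeg z)
            exact_mod_cast Finset.card_le_card (Finset.filter_subset_filter _ (Finset.filter_subset _ _))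
        _ ≤ _ := by
            rw [← Finset.mul_sum]
            gcongr
            have hhalf' : (2 : ℝ) ^ (r + k) / 4 / (2 ^ (r + k) / 2) = 1 / 2 := by
              have : (2 : ℝ) ^ (r + k) ≠ 0 := by positivity
              field_simp
              norm_num
            have := sum_div_dist_rpow_le hα (s := F.image e) (σ := 2 ^ (r + k) / 2)
              (ρ := 2 ^ (r + k) / 4) (by positivity) (by linarith) y ?_ ?_
            · rwa [hhalf'] at this
            · intro _ ha' _ hb' hab
              obtain ⟨a, ha, rfl⟩ := Finset.mem_image.1 ha'
              obtain ⟨b, hb, rfl⟩ := Finset.mem_image.1 hb'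
              have := hsep a (hmem a ha) b (hmem b hb) (by rw [hs a ha, hs b hb]) hab
              rw [hs a ha] at this
              linarith
            · intro _ ha'
              obtain ⟨a, ha, rfl⟩ := Finset.mem_image.1 ha'
              have := hfar a (hmem a ha)
              rw [hs a ha] at this
              linarith
    calc _ ≤ ∑ a ∈ F, 2 * β * 2 ^ α * (1 / 2) ^ k * (2 ^ (r + k) / 2 / dist (e a) y) ^ α :=
          Finset.sum_le_sum hterm
      _ ≤ 2 * β * 2 ^ α * (1 / 2) ^ k * (ψ * (farConst α * (1 / 2) ^ (2 - α))) := by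
          rw [← Finset.mul_sum]
          gcongr
      _ = _ := by ring
  rw [← Finset.sum_fiberwise_of_maps_to (s := L) (t := L.image fun a => s a - r)
    (fun a ha => Finset.mem_image_of_mem _ ha)]
  calc _ ≤ ∑ k ∈ L.image fun a => s a - r,
          2 * β * 2 ^ α * ψ * (farConst α * (1 / 2) ^ (2 - α)) * (1 / 2) ^ k :=
        Finset.sum_le_sum fun k _ => hfib k
    _ ≤ 2 * β * 2 ^ α * ψ * (farConst α * (1 / 2) ^ (2 - α)) * 2 := by
        rw [← Finset.mul_sum]
        gcongr
        exact sum_le_hasSum _ (fun _ _ => by positivity) hasSum_geometric_two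
    _ = _ := by ring

theorem exists_mem_Ico_of_lt {f : ℕ → ℕ} {i : ℕ} (h0 : f 0 ≤ i) :
    ∀ {K : ℕ}, i < f K → ∃ k < K, f k ≤ i ∧ i < f (k + 1)
  | 0, h => absurd h0 (not_le.2 h)
  | K + 1, h => by
    rcases lt_or_ge i (f K) with h' | h'
    · obtain ⟨k, hk, hk'⟩ := exists_mem_Ico_of_lt h0 h'
      exact ⟨k, by omega, hk'⟩
    · exact ⟨K, by omega, h', h⟩

/-- The number of members of a sparse family that are near relative to their scale and whose
contribution is not negligible. -/
theorem card_near_le {L : Finset ι} {s : ι → ℕ} {e : ι → Plane} {ψ : ℝ} (hψ : 0 ≤ ψ)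
    (hsep : ∀ a ∈ L, ∀ b ∈ L, s a ≤ s b → e a ≠ e b → (2 : ℝ) ^ s a ≤ 2 * dist (e a) (e b))
    (hdeg : ∀ z, ((L.filter fun a => e a = z).card : ℝ) ≤ ψ) (y : Plane) {r h K : ℕ}
    (hr : ∀ a ∈ L, r ≤ s a) (hK : ∀ a ∈ L, s a ≤ 2 ^ K)
    (hnear : ∀ a ∈ L, 4 * dist (e a) y < 2 ^ s a)
    (hsig : ∀ a ∈ L, dist (e a) y ^ 2 ≤ 2 ^ (r + s a + 2 * h)) :
    (L.card : ℝ) ≤ ψ * (4 * h + 8 + K) := by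
  classical
  -- The windows `[f k, f (k + 1))` are as long as clustering permits. A gap below `f (k + 1)` and
  -- significance put the endpoint within `ρ` of `y`, where `ρ` has exponent `r + h + f (k + 1) /
  -- 2`; a gap at least `f k` gives scale at least `f k + r`, which is exactly the exponent of `4 *
  -- ρ`.
  set f : ℕ → ℕ := fun k => (2 * h + 4) * (1 + 2 ^ k) with hf
  set A : ℕ → Finset ι := fun i => L.filter fun a => s a = r + i with hA
  set B : ℕ → Finset ι := fun k => L.filter fun a => f k ≤ s a - r ∧ s a - r < f (k + 1) with hB
  have hAcard : ∀ i, ((A i).card : ℝ) ≤ ψ := by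
    intro i
    refine card_le_of_cluster hψ hsep hdeg y (2 ^ (r + i) / 4) (Finset.filter_subset _ _) ?_ ?_
    · intro a ha
      obtain ⟨ha, hs⟩ := Finset.mem_filter.1 ha
      have := hnear a ha
      rw [hs] at this
      linarith
    · intro a ha
      rw [(Finset.mem_filter.1 ha).2]
      linarith
  have hBcard : ∀ k, ((B k).card : ℝ) ≤ ψ := by
    intro k
    refine card_le_of_cluster hψ hsep hdeg y (2 ^ (r + h + (h + 2) * (1 + 2 ^ (k + 1))))
      (Finset.filter_subset _ _) ?_ ?_
    · intro a ha
      obtain ⟨ha, -, hs⟩ := Finset.mem_filter.1 ha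
      refine lt_of_pow_lt_pow_left₀ 2 (by positivity) (lt_of_le_of_lt (hsig a ha) ?_)
      rw [← pow_mul]
      refine pow_lt_pow_right₀ one_lt_two ?_
      have := hr a ha
      have h2 : f (k + 1) = 2 * ((h + 2) * (1 + 2 ^ (k + 1))) := by rw [hf]; ring
      omega
    · intro a ha
      obtain ⟨ha, hs, -⟩ := Finset.mem_filter.1 ha
      have : (4 : ℝ) * 2 ^ (r + h + (h + 2) * (1 + 2 ^ (k + 1))) =
          2 ^ (r + h + (h + 2) * (1 + 2 ^ (k + 1)) + 2) := by
        rw [pow_add _ _ 2]; norm_num; ring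
      rw [this]
      refine pow_le_pow_right₀ one_le_two ?_
      have h1 := hr a ha
      have h2 : f k + r = r + h + (h + 2) * (1 + 2 ^ (k + 1)) + 2 := by rw [hf]; ring
      omega
  -- Gaps below `f 0 = 4 * h + 8` are treated one by one; the larger ones lie in the first `K`
  -- windows because `2 ^ K < f K`.
  have hcover : L ⊆ (Finset.range (4 * h + 8)).biUnion A ∪ (Finset.range K).biUnion B := by
    intro a ha
    rw [Finset.mem_union, Finset.mem_biUnion, Finset.mem_biUnion]
    have h1 := hr a ha
    rcases lt_or_ge (s a - r) (4 * h + 8) with h' | h'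
    · exact Or.inl ⟨s a - r, Finset.mem_range.2 h', Finset.mem_filter.2 ⟨ha, by omega⟩⟩
    · have h0 : f 0 ≤ s a - r := by
        have : f 0 = 4 * h + 8 := by rw [hf]; ring
        omega
      have h2 : s a - r < f K := by
        have h3 := hK a ha
        have h4 : 2 ^ K < f K := by
          rw [hf]
          nlinarith [Nat.zero_le h, Nat.two_pow_pos K]
        omega
      obtain ⟨k, hk, hk'⟩ := exists_mem_Ico_of_lt h0 h2
      exact Or.inr ⟨k, Finset.mem_range.2 hk, Finset.mem_filter.2 ⟨ha, hk'⟩⟩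
  have hcard : L.card ≤ ∑ i ∈ Finset.range (4 * h + 8), (A i).card +
      ∑ k ∈ Finset.range K, (B k).card :=
    (Finset.card_le_card hcover).trans ((Finset.card_union_le _ _).trans
      (add_le_add Finset.card_biUnion_le Finset.card_biUnion_le))
  calc (L.card : ℝ) ≤ ∑ i ∈ Finset.range (4 * h + 8), ((A i).card : ℝ) +
        ∑ k ∈ Finset.range K, ((B k).card : ℝ) := by exact_mod_cast hcard
    _ ≤ ∑ i ∈ Finset.range (4 * h + 8), ψ + ∑ k ∈ Finset.range K, ψ :=
        add_le_add (Finset.sum_le_sum fun i _ => hAcard i) (Finset.sum_le_sum fun k _ => hBcard k)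
    _ = _ := by
        simp only [Finset.sum_const, Finset.card_range, nsmul_eq_mul]
        push_cast
        ring

/-- The total affectance bound at a point from the members of a sparse family of at least the same
scale. -/
theorem sum_pairBound_le {α β ε : ℝ} (hα : 2 < α) (hβ : 0 < β) (hε : 0 < ε) {L : Finset ι}
    {s : ι → ℕ} {e : ι → Plane} {ψ : ℝ} (hψ : 0 ≤ ψ)
    (hsep : ∀ a ∈ L, ∀ b ∈ L, s a ≤ s b → e a ≠ e b → (2 : ℝ) ^ s a ≤ 2 * dist (e a) (e b))
    (hdeg : ∀ z, ((L.filter fun a => e a = z).card : ℝ) ≤ ψ) (y : Plane) {r h K : ℕ}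
    (hr : ∀ a ∈ L, r ≤ s a) (hK : ∀ a ∈ L, s a ≤ 2 ^ K) (hcard : L.card ≤ (2 ^ h) ^ 2) :
    ∑ a ∈ L, pairBound α β ε (r + s a) (dist (e a) y) ≤
      4 * β * 2 ^ α * ψ * (farConst α * (1 / 2) ^ (2 - α)) + 2 * β +
        (1 + ε) * (ψ * (4 * h + 8 + K)) := by
  classical
  -- `F` is the far part, `G₁` the near and significant part, and `G₂` the near part in which every
  -- term is at most `2 * β / (2 ^ h) ^ 2`, so that `hcard` bounds its sum.
  set F := L.filter fun a => (2 : ℝ) ^ s a ≤ 4 * dist (e a) y with hF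
  set G := L.filter fun a => ¬ (2 : ℝ) ^ s a ≤ 4 * dist (e a) y with hG
  set G₁ := G.filter fun a => dist (e a) y ^ 2 ≤ 2 ^ (r + s a + 2 * h) with hG₁
  set G₂ := G.filter fun a => ¬ dist (e a) y ^ 2 ≤ 2 ^ (r + s a + 2 * h) with hG₂
  have hFL : F ⊆ L := Finset.filter_subset _ _
  have hGL : G ⊆ L := Finset.filter_subset _ _
  have hG₁L : G₁ ⊆ L := (Finset.filter_subset _ _).trans hGL
  have hG₂L : G₂ ⊆ L := (Finset.filter_subset _ _).trans hGL
  have hmono : ∀ {L' : Finset ι}, L' ⊆ L → ∀ z, ((L'.filter fun a => e a = z).card : ℝ) ≤ ψ := by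
    intro L' hL' z
    refine le_trans ?_ (hdeg z)
    exact_mod_cast Finset.card_le_card (Finset.filter_subset_filter _ hL')
  have hsum : ∑ a ∈ L, pairBound α β ε (r + s a) (dist (e a) y) =
      ∑ a ∈ F, pairBound α β ε (r + s a) (dist (e a) y) +
      (∑ a ∈ G₁, pairBound α β ε (r + s a) (dist (e a) y) +
        ∑ a ∈ G₂, pairBound α β ε (r + s a) (dist (e a) y)) := by
    rw [hG₁, hG₂, Finset.sum_filter_add_sum_filter_not, hF, hG, Finset.sum_filter_add_sum_filter_not]
  have hFsum : ∑ a ∈ F, pairBound α β ε (r + s a) (dist (e a) y) ≤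
      4 * β * 2 ^ α * ψ * (farConst α * (1 / 2) ^ (2 - α)) := by
    refine le_trans (Finset.sum_le_sum fun a ha => ?_)
      (sum_far_le hα hβ hψ (fun a ha b hb => hsep a (hFL ha) b (hFL hb)) (hmono hFL) y
        (fun a ha => hr a (hFL ha)) (fun a ha => (Finset.mem_filter.1 ha).2))
    refine pairBound_le_of_pos _ _ _ _ ?_
    have h1 := (Finset.mem_filter.1 ha).2
    have h2 : (0 : ℝ) < 2 ^ s a := by positivity
    linarith
  have hG₁sum : ∑ a ∈ G₁, pairBound α β ε (r + s a) (dist (e a) y) ≤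
      (1 + ε) * (ψ * (4 * h + 8 + K)) := by
    refine le_trans (Finset.sum_le_card_nsmul _ _ (1 + ε) fun a _ =>
      pairBound_le_one_add _ _ _ _ _) ?_
    rw [nsmul_eq_mul, mul_comm]
    gcongr
    exact card_near_le hψ (fun a ha b hb => hsep a (hG₁L ha) b (hG₁L hb)) (hmono hG₁L) y
      (fun a ha => hr a (hG₁L ha)) (fun a ha => hK a (hG₁L ha))
      (fun a ha => not_le.1 (Finset.mem_filter.1 (Finset.mem_filter.1 ha).1).2)
      (fun a ha => (Finset.mem_filter.1 ha).2)
  have hG₂sum : ∑ a ∈ G₂, pairBound α β ε (r + s a) (dist (e a) y) ≤ 2 * β := by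
    have hn : (0 : ℝ) < ((2 : ℝ) ^ h) ^ 2 := by positivity
    have hterm : ∀ a ∈ G₂, pairBound α β ε (r + s a) (dist (e a) y) ≤ 2 * β / ((2 : ℝ) ^ h) ^ 2 := by
      intro a ha
      have hlt := not_le.1 (Finset.mem_filter.1 ha).2
      have hD2 : 0 < dist (e a) y ^ 2 := lt_trans (by positivity) hlt
      have hD : 0 < dist (e a) y := by
        rcases (dist_nonneg (x := e a) (y := y)).eq_or_lt with h0 | h0
        · rw [← h0] at hD2; norm_num at hD2
        · exact h0
      refine (pairBound_le_of_pos _ _ _ _ hD).trans ?_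
      rw [div_le_div_iff₀ (by positivity) hn, mul_assoc (2 * β)]
      gcongr
      have h1 : dist (e a) y ^ α = (dist (e a) y ^ 2) ^ (α / 2) := by
        rw [← Real.rpow_natCast _ 2, ← Real.rpow_mul hD.le]
        congr 1
        push_cast
        ring
      have h2 : (((2 : ℝ) ^ h) ^ 2) ≤ (((2 : ℝ) ^ h) ^ 2) ^ (α / 2) := by
        nth_rewrite 1 [← Real.rpow_one (((2 : ℝ) ^ h) ^ 2)]
        exact Real.rpow_le_rpow_of_exponent_le (one_le_pow₀ (one_le_pow₀ one_le_two)) (by linarith)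
      calc ((2 : ℝ) ^ (r + s a)) ^ (α / 2) * ((2 : ℝ) ^ h) ^ 2
          ≤ ((2 : ℝ) ^ (r + s a)) ^ (α / 2) * (((2 : ℝ) ^ h) ^ 2) ^ (α / 2) := by gcongr
        _ = ((2 : ℝ) ^ (r + s a + 2 * h)) ^ (α / 2) := by
            rw [← Real.mul_rpow (by positivity) (by positivity), ← pow_mul, ← pow_add, mul_comm h]
        _ ≤ dist (e a) y ^ α := by
            rw [h1]
            exact Real.rpow_le_rpow (by positivity) hlt.le (by linarith)
    refine (Finset.sum_le_card_nsmul _ _ _ hterm).trans ?_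
    have hc : (G₂.card : ℝ) ≤ ((2 : ℝ) ^ h) ^ 2 := by
      exact_mod_cast (Finset.card_le_card hG₂L).trans hcard
    rw [nsmul_eq_mul, mul_div_assoc', div_le_iff₀ hn, mul_comm]
    gcongr
  rw [hsum]
  linarith

end SINR

namespace SINR

/-! ### The run of the tree construction -/

variable {n : ℕ} {α β N : ℝ} {x : Fin n → Plane} {sel : Finset (Fin n) → Fin n}

theorem mem_heard {r : ℕ} {b : Fin n → Bool} {A : Finset (Fin n)} {u v : Fin n} :
    u ∈ heard α β N x r b A v ↔ u ∈ broadcasters b A ∧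
      Received α β N x (roundPower α β N r) (broadcasters b A) u v ∧
      (2 : ℝ) ^ ((r : ℝ) - 1) ≤ dist (x u) (x v) ∧ dist (x u) (x v) < (2 : ℝ) ^ (r : ℝ) := by
  classical exact Finset.mem_filter

theorem mem_ackers {r : ℕ} {b a : Fin n → Bool} {A : Finset (Fin n)} {v : Fin n} :
    v ∈ ackers α β N x r b a A ↔
      v ∈ A ∧ b v = false ∧ a v = true ∧ (heard α β N x r b A v).Nonempty := by
  classical exact Finset.mem_filter

theorem mem_acksReceived {r : ℕ} {b a : Fin n → Bool} {A : Finset (Fin n)} {u v : Fin n} :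
    v ∈ acksReceived α β N x sel r b a A u ↔ v ∈ ackers α β N x r b a A ∧
      sel (heard α β N x r b A v) = u ∧
      Received α β N x (roundPower α β N r) (ackers α β N x r b a A) v u := by
  classical exact Finset.mem_filter

theorem mem_acknowledged {r : ℕ} {b a : Fin n → Bool} {A : Finset (Fin n)} {u : Fin n} :
    u ∈ acknowledged α β N x sel r b a A ↔
      u ∈ broadcasters b A ∧ (acksReceived α β N x sel r b a A u).Nonempty := by
  classical exact Finset.mem_filter

theorem mem_active_of_mem_acknowledged {r : ℕ} {b a : Fin n → Bool} {A : Finset (Fin n)} {u : Fin n}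
    (h : u ∈ acknowledged α β N x sel r b a A) : u ∈ A :=
  (Finset.mem_filter.1 (mem_acknowledged.1 h).1).1

/-- The distance test is made by the listener on the broadcaster it selects. Since its
acknowledgment is addressed to that very broadcaster, the test passes to the link, whatever the
choice rule. -/
theorem acknowledged_spec (hsel : ∀ S : Finset (Fin n), S.Nonempty → sel S ∈ S) {r : ℕ}
    {b a : Fin n → Bool} {A : Finset (Fin n)} {u : Fin n}
    (h : u ∈ acknowledged α β N x sel r b a A) :
    sel (acksReceived α β N x sel r b a A u) ∈ A ∧
      (2 : ℝ) ^ ((r : ℝ) - 1) ≤ dist (x u) (x (sel (acksReceived α β N x sel r b a A u))) ∧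
      dist (x u) (x (sel (acksReceived α β N x sel r b a A u))) < (2 : ℝ) ^ (r : ℝ) := by
  have hv := mem_acksReceived.1 (hsel _ (mem_acknowledged.1 h).2)
  have hack := mem_ackers.1 hv.1
  have hheard := hsel _ hack.2.2.2
  rw [hv.2.1] at hheard
  exact ⟨hack.1, (mem_heard.1 hheard).2.2⟩

theorem initState_active_antitone (m : ℕ) (A : Finset (Fin n)) (coin : ℕ × Fin n × Bool → Bool) :
    Antitone fun t => (initState α β N x sel m A coin t).active :=
  antitone_nat_of_succ_le fun _ => Finset.sdiff_subset

/-- Causality: the history before a slot-pair is a function of earlier coins, hence independent of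
the coins of that slot-pair. -/
theorem initState_congr {m : ℕ} {A : Finset (Fin n)} {coin coin' : ℕ × Fin n × Bool → Bool} :
    ∀ {t : ℕ}, (∀ t' < t, ∀ w k, coin (t', w, k) = coin' (t', w, k)) →
      initState α β N x sel m A coin t = initState α β N x sel m A coin' t
  | 0, _ => rfl
  | t + 1, h => by
    rw [initState, initState, initState_congr fun t' ht' => h t' (by omega)]
    simp only [h t (by omega)]

/-- A link formed by the construction joins two nodes that are active when it is formed, and its
length fits the round. -/
theorem exists_round_of_mem_links (hsel : ∀ S : Finset (Fin n), S.Nonempty → sel S ∈ S) {m : ℕ}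
    {A : Finset (Fin n)} {coin : ℕ × Fin n × Bool → Bool} {l : Link n} :
    ∀ {t : ℕ}, l ∈ (initState α β N x sel m A coin t).links → ∃ t' < t,
      l.1 ∈ (initState α β N x sel m A coin t').active ∧
      l.2 ∈ (initState α β N x sel m A coin t').active ∧
      (2 : ℝ) ^ (t' / m) ≤ len x l ∧ len x l < (2 : ℝ) ^ (t' / m + 1)
  | 0, h => by simp [initState] at h
  | t + 1, h => by
    rw [initState, slotPair, Finset.mem_union] at h
    rcases h with h | h
    · obtain ⟨t', ht', h'⟩ := exists_round_of_mem_links hsel h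
      exact ⟨t', by omega, h'⟩
    · obtain ⟨u, hu, rfl⟩ := Finset.mem_image.1 h
      obtain ⟨h1, h2, h3⟩ := acknowledged_spec hsel hu
      refine ⟨t, by omega, mem_active_of_mem_acknowledged hu, h1, ?_, ?_⟩
      · rwa [Nat.cast_succ, add_sub_cancel_right, Real.rpow_natCast] at h2
      · rwa [Real.rpow_natCast] at h3

/-! ### A quiet neighbourhood lets a link be formed -/

/-- The factor by which the range of a round has to be enlarged so that all transmitters outside
cause no more interference than the noise. -/
def IsQuietRadius (α β ρ : ℝ) : Prop :=
  1 ≤ ρ ∧ 2 * β * 2 ^ α * (farConst α * (2 * ρ) ^ (2 - α)) ≤ 1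

/-- The exponent `2 - α` is negative, so the interference bound tends to 0 as the radius grows. The
radius depends on `α` and `β` only. -/
theorem exists_isQuietRadius (β : ℝ) (hα : 2 < α) : ∃ ρ, IsQuietRadius α β ρ := by
  have h1 : Filter.Tendsto (fun ρ : ℝ => 2 * β * 2 ^ α * (farConst α * (2 * ρ) ^ (2 - α)))
      Filter.atTop (nhds (2 * β * 2 ^ α * (farConst α * 0))) := by
    refine Filter.Tendsto.const_mul _ (Filter.Tendsto.const_mul _ ?_)
    have h2 := (tendsto_rpow_neg_atTop (y := α - 2) (by linarith)).comp
      (Filter.tendsto_id.const_mul_atTop (two_pos (α := ℝ)))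
    refine h2.congr fun ρ => ?_
    simp
  rw [mul_zero, mul_zero] at h1
  obtain ⟨ρ, h, h'⟩ := ((h1.eventually_le_const one_pos).and
    (Filter.eventually_ge_atTop (1 : ℝ))).exists
  exact ⟨ρ, h', h⟩

/-- The round power makes the signal at least `2 * β * N`, and packing bounds the interference by
`N`, so the ratio is at least `2 * β * N / (N + N) = β`. -/
theorem received_of_quiet (hα : 2 < α) (hβ : 0 < β) (hN : 0 < N) (hx : Function.Injective x)
    {ρ : ℝ} (hρ : IsQuietRadius α β ρ) {r : ℕ} {S : Finset (Fin n)}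
    (hsep : ∀ w ∈ S, ∀ z ∈ S, w ≠ z → (2 : ℝ) ^ r ≤ 2 * dist (x w) (x z)) {u v : Fin n}
    (hu : u ∈ S) (hv : v ∉ S) (huv : dist (x u) (x v) < 2 ^ r)
    (hfar : ∀ w ∈ S, w ≠ u → ρ * 2 ^ r ≤ dist (x w) (x v)) :
    Received α β N x (roundPower α β N r) S u v := by
  classical
  refine ⟨hu, hv, ?_⟩
  have hd : 0 < dist (x u) (x v) := dist_pos.2 fun h => hv (hx h ▸ hu)
  have h2r : (0 : ℝ) < 2 ^ r := by positivity
  have hP : roundPower α β N r = 2 * β * N * ((2 : ℝ) ^ r) ^ α := by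
    rw [roundPower, Real.rpow_mul two_pos.le, Real.rpow_natCast]
  have hsig : 2 * β * N ≤ roundPower α β N r / dist (x u) (x v) ^ α := by
    rw [hP, le_div_iff₀ (by positivity)]
    gcongr
  have hI : ∑ w ∈ S.erase u, roundPower α β N r / dist (x w) (x v) ^ α ≤ N := by
    have hterm : ∀ w ∈ S.erase u, roundPower α β N r / dist (x w) (x v) ^ α =
        2 * β * N * 2 ^ α * ((2 ^ r / 2) / dist (x w) (x v)) ^ α := by
      intro w _
      rw [hP, Real.div_rpow (by positivity) dist_nonneg, Real.div_rpow (by positivity) two_pos.le]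
      have : (2 : ℝ) ^ α ≠ 0 := by positivity
      field_simp
    rw [Finset.sum_congr rfl hterm, ← Finset.mul_sum]
    have hsum := sum_div_dist_rpow_le hα (s := (S.erase u).image x) (σ := 2 ^ r / 2)
      (ρ := ρ * 2 ^ r) (by positivity) (by nlinarith [hρ.1]) (x v) ?_ ?_
    · rw [Finset.sum_image hx.injOn] at hsum
      have h2 : ρ * 2 ^ r / (2 ^ r / 2) = 2 * ρ := by
        field_simp
      rw [h2] at hsum
      calc _ ≤ 2 * β * N * 2 ^ α * (farConst α * (2 * ρ) ^ (2 - α)) := by gcongr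
        _ = N * (2 * β * 2 ^ α * (farConst α * (2 * ρ) ^ (2 - α))) := by ring
        _ ≤ N * 1 := by gcongr; exact hρ.2
        _ = N := mul_one N
    · intro _ ha' _ hb' hab
      obtain ⟨a, ha, rfl⟩ := Finset.mem_image.1 ha'
      obtain ⟨b, hb, rfl⟩ := Finset.mem_image.1 hb'
      have := hsep a (Finset.mem_of_mem_erase ha) b (Finset.mem_of_mem_erase hb)
        fun h => hab (h ▸ rfl)
      linarith
    · intro _ ha'
      obtain ⟨a, ha, rfl⟩ := Finset.mem_image.1 ha'
      exact hfar a (Finset.mem_of_mem_erase ha) (Finset.ne_of_mem_erase ha)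
  have hI0 : 0 ≤ ∑ w ∈ S.erase u, roundPower α β N r / dist (x w) (x v) ^ α :=
    Finset.sum_nonneg fun w _ => by rw [hP]; positivity
  refine (le_div_iff₀ (by linarith)).2 (le_trans ?_ hsig)
  calc _ ≤ β * (N + N) := by gcongr
    _ = 2 * β * N := by ring

open Classical in
/-- The active nodes in the vicinity of `u` or `v`. -/
noncomputable def vicinity (x : Fin n → Plane) (ρ : ℝ) (r : ℕ) (A : Finset (Fin n)) (u v : Fin n) :
    Finset (Fin n) :=
  A.filter fun w => dist (x w) (x u) < ρ * 2 ^ r ∨ dist (x w) (x v) < ρ * 2 ^ r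

/-- Two packing estimates. The bound is free of `n` and `r`, which makes the success probability of
a slot-pair a constant. -/
theorem card_vicinity_le (hx : Function.Injective x) {ρ : ℝ} (hρ : 0 ≤ ρ) {r : ℕ}
    {A : Finset (Fin n)}
    (hsep : ∀ w ∈ A, ∀ z ∈ A, w ≠ z → (2 : ℝ) ^ r ≤ 2 * dist (x w) (x z)) (u v : Fin n) :
    ((vicinity x ρ r A u v).card : ℝ) ≤ 2 * (4 * ρ + 1) ^ 2 := by
  classical
  have key : ∀ z : Fin n, ((A.filter fun w => dist (x w) (x z) < ρ * 2 ^ r).card : ℝ) ≤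
      (4 * ρ + 1) ^ 2 := by
    intro z
    have h := card_le_of_separated (s := (A.filter fun w => dist (x w) (x z) < ρ * 2 ^ r).image x)
      (σ := 2 ^ r / 2) (ρ := ρ * 2 ^ r) (by positivity) (by positivity) (x z) ?_ ?_
    · rw [Finset.card_image_of_injective _ hx] at h
      have h2 : 2 * (ρ * 2 ^ r) / (2 ^ r / 2) = 4 * ρ := by
        have : (2 : ℝ) ^ r ≠ 0 := by positivity
        field_simp
        ring
      rwa [h2] at h
    · intro _ ha' _ hb' hab
      obtain ⟨a, ha, rfl⟩ := Finset.mem_image.1 ha'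
      obtain ⟨b, hb, rfl⟩ := Finset.mem_image.1 hb'
      have := hsep a (Finset.mem_filter.1 ha).1 b (Finset.mem_filter.1 hb).1 fun h => hab (h ▸ rfl)
      linarith
    · intro _ ha'
      obtain ⟨a, ha, rfl⟩ := Finset.mem_image.1 ha'
      exact (Finset.mem_filter.1 ha).2.le
  have h : (vicinity x ρ r A u v).card ≤ (A.filter fun w => dist (x w) (x u) < ρ * 2 ^ r).card +
      (A.filter fun w => dist (x w) (x v) < ρ * 2 ^ r).card := by
    unfold vicinity
    rw [Finset.filter_or]
    exact Finset.card_union_le _ _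
  calc _ ≤ ((A.filter fun w => dist (x w) (x u) < ρ * 2 ^ r).card : ℝ) +
      (A.filter fun w => dist (x w) (x v) < ρ * 2 ^ r).card := by exact_mod_cast h
    _ ≤ _ := by linarith [key u, key v]

/-- If, among the active nodes in the vicinity of `u` and `v`, only `u` has a positive broadcast coin
and only `v` has a positive acknowledgment coin, then `u` is acknowledged. -/
theorem mem_acknowledged_of_quiet (hα : 2 < α) (hβ : 0 < β) (hN : 0 < N)
    (hx : Function.Injective x) (hsel : ∀ S : Finset (Fin n), S.Nonempty → sel S ∈ S)
    {ρ : ℝ} (hρ : IsQuietRadius α β ρ) {r : ℕ} {A : Finset (Fin n)}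
    (hsep : ∀ w ∈ A, ∀ z ∈ A, w ≠ z → (2 : ℝ) ^ r ≤ 2 * dist (x w) (x z)) {u v : Fin n}
    (huA : u ∈ A) (hvA : v ∈ A) (huv : u ≠ v) (hlt : dist (x u) (x v) < 2 ^ r)
    {b a : Fin n → Bool} (hb : ∀ w ∈ vicinity x ρ r A u v, b w = decide (w = u))
    (ha : ∀ w ∈ vicinity x ρ r A u v, a w = decide (w = v)) :
    u ∈ acknowledged α β N x sel r b a A := by
  classical
  have h2r : (0 : ℝ) < 2 ^ r := by positivity
  have hρr : 2 ^ r ≤ ρ * 2 ^ r := le_mul_of_one_le_left h2r.le hρ.1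
  have hρ0 : 0 < ρ * 2 ^ r := h2r.trans_le hρr
  have huQ : u ∈ vicinity x ρ r A u v := by
    refine Finset.mem_filter.2 ⟨huA, Or.inl ?_⟩
    rwa [dist_self]
  have hvQ : v ∈ vicinity x ρ r A u v := by
    refine Finset.mem_filter.2 ⟨hvA, Or.inr ?_⟩
    rwa [dist_self]
  have hbu : b u = true := by simp [hb u huQ]
  have hbv : b v = false := by simp [hb v hvQ, huv.symm]
  have hav : a v = true := by simp [ha v hvQ]
  have huB : u ∈ broadcasters b A := Finset.mem_filter.2 ⟨huA, hbu⟩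
  have hfarB : ∀ w ∈ broadcasters b A, w ≠ u → ρ * 2 ^ r ≤ dist (x w) (x v) := by
    intro w hw hwu
    obtain ⟨hwA, hbw⟩ := Finset.mem_filter.1 hw
    by_contra hlt'
    have := hb w (Finset.mem_filter.2 ⟨hwA, Or.inr (not_le.1 hlt')⟩)
    simp [hbw, hwu] at this
  have hrec : Received α β N x (roundPower α β N r) (broadcasters b A) u v := by
    refine received_of_quiet hα hβ hN hx hρ ?_ huB ?_ hlt hfarB
    · exact fun w hw z hz => hsep w (Finset.mem_filter.1 hw).1 z (Finset.mem_filter.1 hz).1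
    · intro hv
      have := (Finset.mem_filter.1 hv).2
      simp [hbv] at this
  have huH : u ∈ heard α β N x r b A v := by
    refine mem_heard.2 ⟨huB, hrec, ?_, by rwa [Real.rpow_natCast]⟩
    rw [Real.rpow_sub two_pos, Real.rpow_natCast, Real.rpow_one]
    linarith [hsep u huA v hvA huv]
  -- Several messages may be decodable when `β < 1`, but any other broadcaster is at distance at
  -- least `ρ * 2 ^ r ≥ 2 ^ r` from `v` and fails the range test.
  have hselu : sel (heard α β N x r b A v) = u := by
    have h := mem_heard.1 (hsel _ ⟨u, huH⟩)
    by_contra hne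
    have h1 := hfarB _ h.1 hne
    have h2 := h.2.2.2
    rw [Real.rpow_natCast] at h2
    linarith
  have hvK : v ∈ ackers α β N x r b a A := mem_ackers.2 ⟨hvA, hbv, hav, u, huH⟩
  refine mem_acknowledged.2 ⟨huB, v, mem_acksReceived.2 ⟨hvK, hselu, ?_⟩⟩
  refine received_of_quiet hα hβ hN hx hρ ?_ hvK ?_ (by rwa [dist_comm]) ?_
  · exact fun w hw z hz => hsep w (mem_ackers.1 hw).1 z (mem_ackers.1 hz).1
  · intro hu
    have := (mem_ackers.1 hu).2.1
    simp [hbu] at this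
  · intro w hw hwv
    obtain ⟨hwA, -, haw, -⟩ := mem_ackers.1 hw
    by_contra hlt'
    have := ha w (Finset.mem_filter.2 ⟨hwA, Or.inl (not_le.1 hlt')⟩)
    simp [haw, hwv] at this

end SINR

namespace SINR

/-! ### Probability that a close pair of active nodes survives its round -/

section Coins

variable {Ω : Type*} [MeasurableSpace Ω] {μ : Measure Ω} [IsProbabilityMeasure μ] {ι : Type*} {p : ℝ}
  {coin : ι → Ω → Bool}

/-- Tails has probability `1 - p ≥ p`, so prescribing either outcome costs at most a factor `p`. -/
theorem IsIIDCoins.le_measureReal_eq (h : IsIIDCoins μ p coin) (hp' : p ≤ 1 / 2) (i : ι)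
    (k : Bool) : p ≤ μ.real {ω | coin i ω = k} := by
  cases k
  · have hc : {ω | coin i ω = false} = {ω | coin i ω = true}ᶜ := by
      ext ω
      simp
    have hm : MeasurableSet {ω | coin i ω = true} := h.measurable i (measurableSet_singleton true)
    rw [hc, probReal_compl_eq_one_sub hm, h.prob]
    linarith
  · exact (h.prob i).ge

theorem IsIIDCoins.pow_le_measureReal (h : IsIIDCoins μ p coin) (hp : 0 < p) (hp' : p ≤ 1 / 2)
    (T : Finset ι) (τ : ι → Bool) : p ^ T.card ≤ μ.real {ω | ∀ i ∈ T, coin i ω = τ i} := by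
  have h1 := h.indep.measure_inter_preimage_eq_mul T (sets := fun i => {τ i})
    (fun i _ => measurableSet_singleton _)
  have h2 : {ω | ∀ i ∈ T, coin i ω = τ i} = ⋂ i ∈ T, coin i ⁻¹' {τ i} := by
    ext ω
    simp
  rw [h2, measureReal_def, h1, ENNReal.toReal_prod, ← Finset.prod_const]
  exact Finset.prod_le_prod (fun _ _ => hp.le) fun i _ => h.le_measureReal_eq hp' i (τ i)

/-- An event that depends on the coins in `I` only, and the failure to get a given pattern on `T`. -/
theorem IsIIDCoins.measureReal_diff_le (h : IsIIDCoins μ p coin) (hp : 0 < p) (hp' : p ≤ 1 / 2)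
    {I T : Finset ι} (hIT : Disjoint I T) (Φ : Set (I → Bool)) (τ : ι → Bool) :
    μ.real ({ω | (fun i : I => coin i ω) ∈ Φ} \ {ω | ∀ i ∈ T, coin i ω = τ i}) ≤
      (1 - p ^ T.card) * μ.real {ω | (fun i : I => coin i ω) ∈ Φ} := by
  set Ψ : Set (T → Bool) := {g | ∀ i : T, g i = τ i} with hΨ
  have hset : {ω | ∀ i ∈ T, coin i ω = τ i} = (fun ω (i : T) => coin i ω) ⁻¹' Ψ := by
    ext ω
    simp [hΨ]
  have hmeas : Measurable fun ω (i : T) => coin i ω := measurable_pi_lambda _ fun i => h.measurable i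
  have hind := (h.indep.indepFun_finset I T hIT h.measurable).measure_inter_preimage_eq_mul Φ Ψ
    (Set.toFinite _).measurableSet (Set.toFinite _).measurableSet
  have hmul : μ.real ({ω | (fun i : I => coin i ω) ∈ Φ} ∩ {ω | ∀ i ∈ T, coin i ω = τ i}) =
      μ.real {ω | (fun i : I => coin i ω) ∈ Φ} * μ.real {ω | ∀ i ∈ T, coin i ω = τ i} := by
    rw [hset, measureReal_def, measureReal_def, measureReal_def, ← ENNReal.toReal_mul]
    exact congrArg ENNReal.toReal hind
  have hsplit := measureReal_sdiff_add_inter (μ := μ)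
    (s := {ω | (fun i : I => coin i ω) ∈ Φ}) (t := {ω | ∀ i ∈ T, coin i ω = τ i})
    (hset ▸ hmeas (Set.toFinite _).measurableSet)
  have hT := h.pow_le_measureReal hp hp' T τ
  nlinarith [measureReal_nonneg (μ := μ) (s := {ω | (fun i : I => coin i ω) ∈ Φ})]

end Coins

variable {n : ℕ} {α β N : ℝ} {x : Fin n → Plane} {sel : Finset (Fin n) → Fin n}

/-- The nodes of `B` have mutual distance at least `2 ^ r / 2`. -/
def IsSpread (x : Fin n → Plane) (r : ℕ) (B : Finset (Fin n)) : Prop :=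
  ∀ w ∈ B, ∀ z ∈ B, w ≠ z → (2 : ℝ) ^ r ≤ 2 * dist (x w) (x z)

theorem IsSpread.mono {r : ℕ} {B B' : Finset (Fin n)} (h : IsSpread x r B) (hB : B' ⊆ B) :
    IsSpread x r B' :=
  fun w hw z hz => h w (hB hw) z (hB hz)

/-- Both `u` and `v` are active after `t` slot-pairs, and the active nodes were spread at the start
of round `r`. -/
def BothActive (α β N : ℝ) (x : Fin n → Plane) (sel : Finset (Fin n) → Fin n) (m : ℕ)
    (A : Finset (Fin n)) (r : ℕ) (u v : Fin n) (t : ℕ) (coin : ℕ × Fin n × Bool → Bool) : Prop :=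
  u ∈ (initState α β N x sel m A coin t).active ∧ v ∈ (initState α β N x sel m A coin t).active ∧
    IsSpread x r (initState α β N x sel m A coin ((r - 1) * m)).active

/-- A lower bound for the probability that a pair of active nodes loses a member in a slot-pair. -/
noncomputable def successProb (p ρ : ℝ) : ℝ := p ^ (2 * ⌊2 * (4 * ρ + 1) ^ 2⌋₊)

variable {Ω : Type*} [MeasurableSpace Ω] {μ : Measure Ω} [IsProbabilityMeasure μ] {p : ℝ}
  {coin : ℕ × Fin n × Bool → Ω → Bool}

/-- Split according to the active set `B` after `t` slot-pairs. This is decided by earlier coins,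
whereas the pattern that removes `u` involves only coins of slot-pair `t` at nodes of the vicinity
in `B`. Independence gives the factor for each `B`, and the disjoint events are summed. -/
theorem measureReal_bothActive_succ_le (hα : 2 < α) (hβ : 0 < β) (hN : 0 < N) (hp : 0 < p)
    (hp' : p ≤ 1 / 2) (hx : Function.Injective x)
    (hsel : ∀ S : Finset (Fin n), S.Nonempty → sel S ∈ S) {ρ : ℝ} (hρ : IsQuietRadius α β ρ)
    (hcoin : IsIIDCoins μ p coin) {m : ℕ} {A : Finset (Fin n)} {r t : ℕ} (ht : t / m + 1 = r)
    {u v : Fin n} (huv : u ≠ v) (hlt : dist (x u) (x v) < 2 ^ r) :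
    μ.real {ω | BothActive α β N x sel m A r u v (t + 1) fun i => coin i ω} ≤
      (1 - successProb p ρ) *
        μ.real {ω | BothActive α β N x sel m A r u v t fun i => coin i ω} := by
  classical
  have hrt : (r - 1) * m ≤ t := by
    rw [← ht, Nat.add_sub_cancel]
    exact Nat.div_mul_le_self t m
  set I : Finset (ℕ × Fin n × Bool) := Finset.range t ×ˢ Finset.univ with hI
  -- The filler `false` is never read: states up to time `t` depend on coins in `I` only.
  let extend : (I → Bool) → ℕ × Fin n × Bool → Bool :=
    fun g i => if h : i ∈ I then g ⟨i, h⟩ else false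
  have hextend : ∀ ω, ∀ t' ≤ t, initState α β N x sel m A (extend fun i => coin i ω) t' =
      initState α β N x sel m A (fun i => coin i ω) t' := by
    intro ω t' ht'
    refine initState_congr fun t'' ht'' w k => ?_
    have : (t'', w, k) ∈ I := by simp [hI]; omega
    simp [extend, this]
  let Φ : Finset (Fin n) → Set (I → Bool) := fun B => {g |
    (initState α β N x sel m A (extend g) t).active = B ∧
      BothActive α β N x sel m A r u v t (extend g)}
  let T : Finset (Fin n) → Finset (ℕ × Fin n × Bool) :=
    fun B => {t} ×ˢ (vicinity x ρ r B u v ×ˢ Finset.univ)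
  let τ : ℕ × Fin n × Bool → Bool := fun i => if i.2.2 then decide (i.2.1 = v) else decide (i.2.1 = u)
  let H : Finset (Fin n) → Set Ω := fun B => {ω | (fun i : I => coin i ω) ∈ Φ B}
  let S : Finset (Fin n) → Set Ω := fun B => {ω | ∀ i ∈ T B, coin i ω = τ i}
  have hH : ∀ B ω, ω ∈ H B ↔ (initState α β N x sel m A (fun i => coin i ω) t).active = B ∧
      BothActive α β N x sel m A r u v t fun i => coin i ω := by
    intro B ω
    simp only [H, Φ, Set.mem_ofPred_eq, BothActive, hextend ω t le_rfl, hextend ω _ hrt]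
  have hdisj : ∀ B, Disjoint I (T B) := by
    intro B
    rw [Finset.disjoint_left]
    intro i hi hi'
    simp only [hI, T, Finset.mem_product, Finset.mem_range, Finset.mem_singleton] at hi hi'
    omega
  have hprob : ∀ B, μ.real (H B \ S B) ≤ (1 - successProb p ρ) * μ.real (H B) := by
    intro B
    rcases (H B).eq_empty_or_nonempty with he | ⟨ω, hω⟩
    -- If `H B` is empty, `B` need not be spread and no packing bound is available, but none is
    -- needed.
    · simp [he]
    obtain ⟨hB, -, -, hspread⟩ := (hH B ω).1 hω
    have hBs : IsSpread x r B := hB ▸ hspread.mono (initState_active_antitone m A _ hrt)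
    have hcard : (T B).card ≤ 2 * ⌊2 * (4 * ρ + 1) ^ 2⌋₊ := by
      have h1 := Nat.le_floor (card_vicinity_le hx (zero_le_one.trans hρ.1) hBs u v)
      simp only [T, Finset.card_product, Finset.card_singleton, Finset.card_univ, Fintype.card_bool]
      omega
    refine (hcoin.measureReal_diff_le hp hp' (hdisj B) (Φ B) τ).trans ?_
    refine mul_le_mul_of_nonneg_right ?_ measureReal_nonneg
    have := pow_le_pow_of_le_one hp.le (by linarith) hcard
    simp only [successProb]
    linarith
  have hsub : {ω | BothActive α β N x sel m A r u v (t + 1) fun i => coin i ω} ⊆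
      ⋃ B ∈ (Finset.univ : Finset (Finset (Fin n))), H B \ S B := by
    intro ω hω
    obtain ⟨hu, hv, hspread⟩ := hω
    simp only [Set.mem_iUnion, Finset.mem_univ, exists_prop, true_and]
    have hmono := initState_active_antitone (α := α) (β := β) (N := N) (x := x) (sel := sel) m A
      (fun i => coin i ω) (Nat.le_add_right t 1)
    refine ⟨(initState α β N x sel m A (fun i => coin i ω) t).active,
      (hH _ _).2 ⟨rfl, hmono hu, hmono hv, hspread⟩, fun hS => ?_⟩
    have hu' := hu
    rw [initState, slotPair, ht] at hu'
    refine (Finset.mem_sdiff.1 hu').2 ?_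
    refine mem_acknowledged_of_quiet hα hβ hN hx hsel hρ
      (hspread.mono (initState_active_antitone m A _ hrt)) (hmono hu) (hmono hv) huv hlt ?_ ?_
    · intro w hw
      exact hS (t, w, false) (by simp [T, hw])
    · intro w hw
      exact hS (t, w, true) (by simp [T, hw])
  have hunion : {ω | BothActive α β N x sel m A r u v t fun i => coin i ω} =
      ⋃ B ∈ (Finset.univ : Finset (Finset (Fin n))), H B := by
    ext ω
    simp only [Set.mem_iUnion, Finset.mem_univ, exists_prop, true_and, hH, Set.mem_ofPred_eq]
    exact ⟨fun h => ⟨_, rfl, h⟩, fun ⟨_, _, h⟩ => h⟩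
  have hmeasH : ∀ B, MeasurableSet (H B) := by
    intro B
    have : Measurable fun ω (i : I) => coin i ω := measurable_pi_lambda _ fun i => hcoin.measurable i
    exact this (Set.toFinite (Φ B)).measurableSet
  have hdisjH : Set.PairwiseDisjoint
      ((Finset.univ : Finset (Finset (Fin n))) : Set (Finset (Fin n))) H := by
    intro B _ B' _ hne
    refine Set.disjoint_left.2 fun ω h h' => hne ?_
    rw [← ((hH B ω).1 h).1, ((hH B' ω).1 h').1]
  calc _ ≤ μ.real (⋃ B ∈ (Finset.univ : Finset (Finset (Fin n))), H B \ S B) :=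
        measureReal_mono hsub (measure_ne_top μ _)
    _ ≤ ∑ B, μ.real (H B \ S B) := measureReal_biUnion_finset_le _ _
    _ ≤ ∑ B, (1 - successProb p ρ) * μ.real (H B) := Finset.sum_le_sum fun B _ => hprob B
    _ = _ := by
        rw [← Finset.mul_sum, hunion, measureReal_biUnion_finset hdisjH fun B _ => hmeasH B]

theorem successProb_pos (hp : 0 < p) (ρ : ℝ) : 0 < successProb p ρ := pow_pos hp _

theorem successProb_le_one (hp : 0 < p) (hp' : p ≤ 1 / 2) (ρ : ℝ) : successProb p ρ ≤ 1 :=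
  pow_le_one₀ hp.le (by linarith)

theorem measureReal_bothActive_le (hα : 2 < α) (hβ : 0 < β) (hN : 0 < N) (hp : 0 < p)
    (hp' : p ≤ 1 / 2) (hx : Function.Injective x)
    (hsel : ∀ S : Finset (Fin n), S.Nonempty → sel S ∈ S) {ρ : ℝ} (hρ : IsQuietRadius α β ρ)
    (hcoin : IsIIDCoins μ p coin) {m : ℕ} {A : Finset (Fin n)} {r : ℕ} (hr : 1 ≤ r)
    {u v : Fin n} (huv : u ≠ v) (hlt : dist (x u) (x v) < 2 ^ r) :
    μ.real {ω | BothActive α β N x sel m A r u v (r * m) fun i => coin i ω} ≤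
      (1 - successProb p ρ) ^ m := by
  have key : ∀ k ≤ m, μ.real {ω | BothActive α β N x sel m A r u v ((r - 1) * m + k)
      fun i => coin i ω} ≤ (1 - successProb p ρ) ^ k := by
    intro k
    induction k with
    | zero => intro _; simp
    | succ k ih =>
      intro hk
      -- Slot-pairs count from 0 and rounds from 1, so these `m` slot-pairs make up round `r`.
      have ht : ((r - 1) * m + k) / m + 1 = r := by
        rw [mul_comm, Nat.mul_add_div (by omega), Nat.div_eq_of_lt (by omega)]
        omega
      rw [pow_succ', ← add_assoc]
      refine (measureReal_bothActive_succ_le hα hβ hN hp hp' hx hsel hρ hcoin ht huv hlt).trans ?_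
      exact mul_le_mul_of_nonneg_left (ih (by omega)) (by linarith [successProb_le_one hp hp' ρ])
  have hrm : (r - 1) * m + m = r * m := by
    nth_rewrite 2 [← one_mul m]
    rw [← add_mul, Nat.sub_add_cancel hr]
  simpa only [hrm] using key m le_rfl

/-- At the end of each round `r ≤ R`, the active nodes have mutual distance at least `2 ^ r`. -/
def RoundsSpread (α β N : ℝ) (x : Fin n → Plane) (sel : Finset (Fin n) → Fin n) (m R : ℕ)
    (A : Finset (Fin n)) (coin : ℕ × Fin n × Bool → Bool) : Prop :=
  ∀ r ≤ R, IsSpread x (r + 1) (initState α β N x sel m A coin (r * m)).active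

/-- If the active nodes fail to be spread at the end of some round, then in the first such round a
close pair of active nodes has survived. -/
theorem exists_bothActive_of_not_roundsSpread {m R : ℕ} {A : Finset (Fin n)}
    {coin : ℕ × Fin n × Bool → Bool} (hx : ∀ u v, u ≠ v → 1 ≤ dist (x u) (x v))
    (h : ¬ RoundsSpread α β N x sel m R A coin) :
    ∃ r u v, 1 ≤ r ∧ u ≠ v ∧ (2 : ℝ) ^ r ≤ 2 * dist (x u) (x v) ∧ dist (x u) (x v) < 2 ^ r ∧
      BothActive α β N x sel m A r u v (r * m) coin := by
  classical
  have hex : ∃ r, ¬ IsSpread x (r + 1) (initState α β N x sel m A coin (r * m)).active := by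
    unfold RoundsSpread at h
    push Not at h
    obtain ⟨r, -, hr⟩ := h
    exact ⟨r, hr⟩
  set r := Nat.find hex with hr
  have hspec := Nat.find_spec hex
  rw [← hr] at hspec
  have hr1 : 1 ≤ r := by
    by_contra h0
    have h0 : r = 0 := by omega
    rw [h0] at hspec
    refine hspec fun w _ z _ hwz => ?_
    rw [zero_add, pow_one]
    linarith [hx w z hwz]
  have hprev : IsSpread x r (initState α β N x sel m A coin ((r - 1) * m)).active := by
    have := Nat.find_min hex (m := r - 1) (by omega)
    rwa [not_not, Nat.sub_add_cancel hr1] at this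
  unfold IsSpread at hspec
  push Not at hspec
  obtain ⟨u, hu, v, hv, huv, hlt⟩ := hspec
  have hmono := initState_active_antitone (α := α) (β := β) (N := N) (x := x) (sel := sel) m A coin
    (Nat.mul_le_mul_right m (Nat.sub_le r 1))
  refine ⟨r, u, v, hr1, huv, hprev u (hmono hu) v (hmono hv) huv, ?_, hu, hv, hprev⟩
  rw [pow_succ] at hlt
  linarith

/-- The distance of a pair determines the only round in which its survival can be the first
violation. The union bound therefore runs over pairs of nodes, not over rounds. -/
theorem one_sub_le_measureReal_roundsSpread (hα : 2 < α) (hβ : 0 < β) (hN : 0 < N) (hp : 0 < p)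
    (hp' : p ≤ 1 / 2) (hx : ∀ u v, u ≠ v → 1 ≤ dist (x u) (x v))
    (hsel : ∀ S : Finset (Fin n), S.Nonempty → sel S ∈ S) {ρ : ℝ} (hρ : IsQuietRadius α β ρ)
    (hcoin : IsIIDCoins μ p coin) (m R : ℕ) (A : Finset (Fin n)) :
    1 - (n : ℝ) ^ 2 * (1 - successProb p ρ) ^ m ≤
      μ.real {ω | RoundsSpread α β N x sel m R A fun i => coin i ω} := by
  classical
  have hinj : Function.Injective x := by
    intro u v h
    by_contra hne
    have := hx u v hne
    rw [h, dist_self] at this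
    linarith
  have hq : 0 ≤ 1 - successProb p ρ := by linarith [successProb_le_one hp hp' ρ]
  let bad : Fin n × Fin n → Set Ω := fun w => {ω | w.1 ≠ w.2 ∧ ∃ r, 1 ≤ r ∧
    (2 : ℝ) ^ r ≤ 2 * dist (x w.1) (x w.2) ∧ dist (x w.1) (x w.2) < 2 ^ r ∧
      BothActive α β N x sel m A r w.1 w.2 (r * m) fun i => coin i ω}
  have hbad : ∀ w, μ.real (bad w) ≤ (1 - successProb p ρ) ^ m := by
    intro w
    rcases (bad w).eq_empty_or_nonempty with he | ⟨ω₀, hne, r₀, hr₀, hle₀, hlt₀, -⟩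
    · rw [he]
      simpa using pow_nonneg hq m
    refine le_trans (measureReal_mono ?_)
      (measureReal_bothActive_le hα hβ hN hp hp' hinj hsel hρ hcoin (A := A) (m := m) hr₀ hne hlt₀)
    rintro ω ⟨-, r, hr, hle, hlt, hb⟩
    have h1 : r < r₀ + 1 := by
      refine (pow_lt_pow_iff_right₀ (one_lt_two (α := ℝ))).1 ?_
      rw [pow_succ]
      linarith
    have h2 : r₀ < r + 1 := by
      refine (pow_lt_pow_iff_right₀ (one_lt_two (α := ℝ))).1 ?_
      rw [pow_succ]
      linarith
    have h3 : r = r₀ := by omega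
    rwa [h3] at hb
  have hsub : {ω | RoundsSpread α β N x sel m R A fun i => coin i ω}ᶜ ⊆
      ⋃ w ∈ (Finset.univ : Finset (Fin n × Fin n)), bad w := by
    intro ω hω
    obtain ⟨r, u, v, hr, huv, hle, hlt, hb⟩ := exists_bothActive_of_not_roundsSpread hx hω
    simp only [Set.mem_iUnion, Finset.mem_univ, exists_prop, true_and]
    exact ⟨(u, v), huv, r, hr, hle, hlt, hb⟩
  have hcompl : μ.real {ω | RoundsSpread α β N x sel m R A fun i => coin i ω}ᶜ ≤
      (n : ℝ) ^ 2 * (1 - successProb p ρ) ^ m := by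
    refine (measureReal_mono hsub (measure_ne_top μ _)).trans ((measureReal_biUnion_finset_le _ _).trans
      ((Finset.sum_le_sum fun w _ => hbad w).trans (le_of_eq ?_)))
    rw [Finset.sum_const, Finset.card_univ, Fintype.card_prod, Fintype.card_fin, nsmul_eq_mul]
    push_cast
    ring
  have huniv := measureReal_union_le (μ := μ)
    {ω | RoundsSpread α β N x sel m R A fun i => coin i ω}
    {ω | RoundsSpread α β N x sel m R A fun i => coin i ω}ᶜ
  rw [Set.union_compl_self, probReal_univ] at huniv
  linarith

end SINR

namespace SINR

/-! ### Total affectance of the low-degree part of the tree -/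

variable {n : ℕ} {α β N : ℝ} {x : Fin n → Plane} {sel : Finset (Fin n) → Fin n}

/-- Each link of the tree has a scale, namely the round in which it was formed. -/
theorem exists_scale (hsel : ∀ S : Finset (Fin n), S.Nonempty → sel S ∈ S) {m R : ℕ}
    {A : Finset (Fin n)} {coin : ℕ × Fin n × Bool → Bool}
    (hspread : RoundsSpread α β N x sel m R A coin) :
    ∃ s : Link n → ℕ, ∀ l ∈ (initState α β N x sel m A coin (R * m)).links,
      (2 : ℝ) ^ s l ≤ 2 * len x l ∧ len x l < 2 ^ s l ∧
      l.1 ∈ (initState α β N x sel m A coin ((s l - 1) * m)).active ∧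
      l.2 ∈ (initState α β N x sel m A coin ((s l - 1) * m)).active ∧
      IsSpread x (s l) (initState α β N x sel m A coin ((s l - 1) * m)).active := by
  have hex : ∀ l : Link n, ∃ k : ℕ, l ∈ (initState α β N x sel m A coin (R * m)).links →
      (2 : ℝ) ^ k ≤ 2 * len x l ∧ len x l < 2 ^ k ∧
      l.1 ∈ (initState α β N x sel m A coin ((k - 1) * m)).active ∧
      l.2 ∈ (initState α β N x sel m A coin ((k - 1) * m)).active ∧
      IsSpread x k (initState α β N x sel m A coin ((k - 1) * m)).active := by
    intro l
    by_cases hl : l ∈ (initState α β N x sel m A coin (R * m)).links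
    · obtain ⟨t, ht, h1, h2, h3, h4⟩ := exists_round_of_mem_links hsel hl
      have hmono := initState_active_antitone (α := α) (β := β) (N := N) (x := x) (sel := sel) m A
        coin (Nat.div_mul_le_self t m)
      refine ⟨t / m + 1, fun _ => ⟨?_, h4, hmono h1, hmono h2, hspread _ ?_⟩⟩
      · rw [pow_succ]
        linarith
      · rw [mul_comm] at ht
        exact (Nat.div_lt_of_lt_mul ht).le
    · exact ⟨0, fun h => absurd h hl⟩
  choose s hs using hex
  exact ⟨s, hs⟩

/-- Mean power turns the numerator into `(len x l * len x l') ^ (α / 2)` and cancels `K`. The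
resulting symmetry lets the same estimate serve for affectance received and affectance caused. -/
theorem affectance_le_pairBound (hβ : 0 < β) {ε K : ℝ} (hK : 0 < K) (hα : 2 < α) {l l' : Link n}
    (hl : 0 < len x l) (hl' : 0 < len x l')
    (hc : noiseFactor α β N x (meanPower α K x) l ≤ 2 * β) {a b : ℕ} (ha : len x l ≤ 2 ^ a)
    (hb : len x l' ≤ 2 ^ b) :
    affectance α β N ε x (meanPower α K x) l' l ≤
      pairBound α β ε (a + b) (dist (x l'.1) (x l.2)) := by
  unfold affectance pairBound
  split_ifs with h
  · exact le_rfl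
  refine min_le_min_left _ ?_
  have hd : 0 < dist (x l'.1) (x l.2) := lt_of_le_of_ne dist_nonneg (Ne.symm h)
  have hpow : len x l ^ α = len x l ^ (α / 2) * len x l ^ (α / 2) := by
    rw [← Real.rpow_add hl, add_halves]
  have hpos : 0 < len x l ^ (α / 2) := Real.rpow_pos_of_pos hl _
  have heq : meanPower α K x l' / meanPower α K x l * (len x l / dist (x l'.1) (x l.2)) ^ α =
      (len x l * len x l') ^ (α / 2) / dist (x l'.1) (x l.2) ^ α := by
    rw [Real.div_rpow hl.le hd.le, hpow, Real.mul_rpow hl.le hl'.le, meanPower, meanPower]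
    field_simp
  rw [mul_assoc, heq, mul_div_assoc, pow_add]
  refine mul_le_mul hc ?_ (by positivity) (by positivity)
  gcongr

theorem natCast_clog_two_le {k : ℕ} (hk : 1 ≤ k) : (Nat.clog 2 k : ℝ) ≤ 2 * Real.log k + 1 := by
  have h1 : (1 : ℝ) ≤ k := by exact_mod_cast hk
  have h0 : 0 ≤ Real.log k := Real.log_nonneg h1
  have h2 : 0 ≤ Real.logb 2 k := Real.logb_nonneg one_lt_two h1
  have h3 := Real.natCeil_logb_natCast 2 k
  rw [← h3]
  refine (Nat.ceil_lt_add_one (by exact_mod_cast h2)).le.trans ?_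
  have h4 : Real.logb 2 k ≤ 2 * Real.log k := by
    rw [Real.logb, div_le_iff₀ (Real.log_pos one_lt_two)]
    nlinarith [Real.log_two_gt_d9]
  push_cast
  linarith

theorem half_le_log (hn : 2 ≤ n) : 1 / 2 ≤ Real.log n := by
  have h1 : Real.log 2 ≤ Real.log n :=
    Real.log_le_log two_pos (by exact_mod_cast hn)
  linarith [Real.log_two_gt_d9]

/-- The number of scales that matter is `O(Υ)`. -/
theorem scales_le_upsilon (hn : 2 ≤ n) (hΔ : 1 ≤ maxDist x) :
    4 * (Nat.clog 2 n : ℝ) + 8 + (Nat.clog 2 (⌊Real.logb 2 (maxDist x)⌋₊ + 1) : ℝ) ≤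
      40 * upsilon x := by
  have hlog := half_le_log hn
  have h1 := natCast_clog_two_le (k := n) (by omega)
  have h2 := natCast_clog_two_le (k := ⌊Real.logb 2 (maxDist x)⌋₊ + 1) (by omega)
  have hlΔ : 0 ≤ Real.log (maxDist x) := Real.log_nonneg hΔ
  have h3 : ((⌊Real.logb 2 (maxDist x)⌋₊ + 1 : ℕ) : ℝ) ≤ 4 * max (Real.log (maxDist x)) 1 := by
    have h4 := Nat.floor_le (Real.logb_nonneg one_lt_two hΔ)
    have h5 : Real.logb 2 (maxDist x) ≤ 2 * Real.log (maxDist x) := by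
      rw [Real.logb, div_le_iff₀ (Real.log_pos one_lt_two)]
      nlinarith [Real.log_two_gt_d9]
    push_cast
    linarith [le_max_left (Real.log (maxDist x)) 1, le_max_right (Real.log (maxDist x)) 1]
  have h4 : Real.log (max (Real.log (maxDist x)) 1) ≤ max (Real.log (Real.log (maxDist x))) 0 := by
    rcases le_total (Real.log (maxDist x)) 1 with h | h
    · rw [max_eq_right h, Real.log_one]
      exact le_max_right _ _
    · rw [max_eq_left h]
      exact le_max_left _ _
  have h5 : Real.log ((⌊Real.logb 2 (maxDist x)⌋₊ + 1 : ℕ) : ℝ) ≤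
      2 * Real.log 2 + max (Real.log (Real.log (maxDist x))) 0 := by
    have h6 : (0 : ℝ) < max (Real.log (maxDist x)) 1 := lt_max_of_lt_right one_pos
    refine (Real.log_le_log (by positivity) h3).trans ?_
    rw [Real.log_mul (by norm_num) h6.ne', show (4 : ℝ) = 2 ^ 2 by norm_num, Real.log_pow]
    push_cast
    linarith
  have h6 : 0 ≤ max (Real.log (Real.log (maxDist x))) 0 := le_max_right _ _
  unfold upsilon
  -- The total is at most `8 log n + 2 log log Δ + 13 + 4 log 2`, with `log log Δ` truncated at 0;
  -- since `1 ≤ 2 log n`, the coefficient of `log n` stays below 40.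
  linarith [Real.log_two_lt_d9]

/-- The constant in the bound for the total affectance. -/
noncomputable def affectanceConst (α β ε ψ : ℝ) : ℝ :=
  2 * (4 * β * 2 ^ α * ψ * (farConst α * (1 / 2) ^ (2 - α)) + 2 * β) + (1 + ε) * (ψ * 40)

theorem affectanceConst_pos {ε ψ : ℝ} (hα : 2 < α) (hβ : 0 < β) (hε : 0 < ε) (hψ : 0 ≤ ψ) :
    0 < affectanceConst α β ε ψ := by
  have := farConst_pos hα
  unfold affectanceConst
  positivity

/-- If the active nodes are spread after each round, then the low-degree part of the tree has average
affectance `O(Υ)`. -/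
theorem totalAffectance_le {ε K ψ : ℝ} (hα : 2 < α) (hβ : 0 < β) (hε : 0 < ε) (hK : 0 < K)
    (hψ : 0 ≤ ψ) (hx : ∀ u v, u ≠ v → 1 ≤ dist (x u) (x v)) {A : Finset (Fin n)}
    (hA : ∀ u ∈ A, ∀ v ∈ A, u ≠ v → noiseFactor α β N x (meanPower α K x) (u, v) ≤ 2 * β)
    (hsel : ∀ S : Finset (Fin n), S.Nonempty → sel S ∈ S) {m R : ℕ}
    {coin : ℕ × Fin n × Bool → Bool} (hspread : RoundsSpread α β N x sel m R A coin) :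
    totalAffectance α β N ε x (meanPower α K x)
        (lowDegreeLinks ψ (initState α β N x sel m A coin (R * m)).links) ≤
      2 * affectanceConst α β ε ψ * upsilon x *
        ((lowDegreeLinks ψ (initState α β N x sel m A coin (R * m)).links).card : ℝ) := by
  classical
  obtain ⟨s, hs⟩ := exists_scale hsel hspread
  set T := (initState α β N x sel m A coin (R * m)).links with hT
  set L := lowDegreeLinks ψ T with hL
  have hmem : ∀ l ∈ L, l ∈ T ∧ (degree T l.1 : ℝ) ≤ ψ ∧ (degree T l.2 : ℝ) ≤ ψ :=
    fun l hl => Finset.mem_filter.1 hl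
  rcases L.eq_empty_or_nonempty with he | ⟨l₀, hl₀⟩
  · simp [he, totalAffectance]
  have hlen : ∀ l ∈ L, 0 < len x l := by
    intro l hl
    have h1 := (hs l (hmem l hl).1).1
    have h2 : (0 : ℝ) < 2 ^ s l := by positivity
    linarith
  have hne : ∀ l ∈ L, l.1 ≠ l.2 := by
    intro l hl h
    have := hlen l hl
    rw [len, h, dist_self] at this
    exact lt_irrefl _ this
  have hinA : ∀ t, (initState α β N x sel m A coin t).active ⊆ A :=
    fun t => initState_active_antitone m A coin (Nat.zero_le t)
  have hn : 2 ≤ n := by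
    have h1 : (l₀.1 : ℕ) ≠ l₀.2 := fun h => hne l₀ hl₀ (Fin.ext h)
    have h2 := l₀.1.isLt
    have h3 := l₀.2.isLt
    omega
  have hdiam : ∀ l ∈ L, len x l ≤ maxDist x := fun l _ =>
    Metric.dist_le_diam_of_mem (Set.finite_range x).isBounded (Set.mem_range_self _)
      (Set.mem_range_self _)
  have hΔ : 1 ≤ maxDist x := (hx _ _ (hne l₀ hl₀)).trans (hdiam l₀ hl₀)
  have hscale : ∀ l ∈ L, s l ≤ 2 ^ Nat.clog 2 (⌊Real.logb 2 (maxDist x)⌋₊ + 1) := by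
    intro l hl
    refine le_trans ?_ (Nat.le_pow_clog one_lt_two _)
    rcases Nat.eq_zero_or_pos (s l) with h0 | h0
    · omega
    have h1 : (2 : ℝ) ^ (s l - 1) ≤ maxDist x := by
      have h2 := (hs l (hmem l hl).1).1
      rw [← Nat.sub_add_cancel h0, pow_succ] at h2
      linarith [hdiam l hl]
    have h2 : s l - 1 ≤ ⌊Real.logb 2 (maxDist x)⌋₊ := by
      refine Nat.le_floor ((Real.le_logb_iff_rpow_le one_lt_two (by linarith)).2 ?_)
      rwa [Real.rpow_natCast]
    omega
  have hcard : L.card ≤ (2 ^ Nat.clog 2 n) ^ 2 := by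
    calc L.card ≤ (Finset.univ : Finset (Link n)).card := Finset.card_le_card (Finset.subset_univ _)
      _ = n ^ 2 := by
        rw [Finset.card_univ, Fintype.card_prod, Fintype.card_fin, sq]
      _ ≤ _ := Nat.pow_le_pow_left (Nat.le_pow_clog one_lt_two n) 2
  have hdegree : ∀ f : Link n → Fin n, (∀ l, f l = l.1 ∨ f l = l.2) → ∀ z : Plane,
      ((L.filter fun l => x (f l) = z).card : ℝ) ≤ ψ := by
    intro f hf z
    rcases (L.filter fun l => x (f l) = z).eq_empty_or_nonempty with he | ⟨l₁, hl₁⟩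
    · simpa [he] using hψ
    obtain ⟨hl₁L, hz⟩ := Finset.mem_filter.1 hl₁
    have hdeg : (degree T (f l₁) : ℝ) ≤ ψ := by
      rcases hf l₁ with h | h <;> rw [h]
      · exact (hmem l₁ hl₁L).2.1
      · exact (hmem l₁ hl₁L).2.2
    refine le_trans ?_ hdeg
    have hsub : (L.filter fun l => x (f l) = z) ⊆ T.filter fun l => l.1 = f l₁ ∨ l.2 = f l₁ := by
      intro l hl
      obtain ⟨hlL, hlz⟩ := Finset.mem_filter.1 hl
      have hfl : f l = f l₁ := by
        by_contra hne'
        have := hx _ _ hne'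
        rw [hlz, hz, dist_self] at this
        linarith
      refine Finset.mem_filter.2 ⟨(hmem l hlL).1, ?_⟩
      rcases hf l with h | h
      · exact Or.inl (h ▸ hfl)
      · exact Or.inr (h ▸ hfl)
    exact_mod_cast Finset.card_le_card hsub
  -- Needed twice: with `f` the sender, around the receiver of a shorter affected link; with `f` the
  -- receiver, around the sender of a shorter affecting link.
  have hinner : ∀ f : Link n → Fin n, (∀ l, f l = l.1 ∨ f l = l.2) → ∀ (y : Plane) (r : ℕ),
      ∑ l ∈ L with r ≤ s l, pairBound α β ε (r + s l) (dist (x (f l)) y) ≤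
        affectanceConst α β ε ψ * upsilon x := by
    intro f hf y r
    have hsubL : (L.filter fun l => r ≤ s l) ⊆ L := Finset.filter_subset _ _
    have hend : ∀ l ∈ L, f l ∈ (initState α β N x sel m A coin ((s l - 1) * m)).active := by
      intro l hl
      obtain ⟨-, -, h1, h2, -⟩ := hs l (hmem l hl).1
      rcases hf l with h | h <;> rw [h] <;> assumption
    have h := sum_pairBound_le hα hβ hε (L := L.filter fun l => r ≤ s l) (s := s)
      (e := fun l => x (f l)) (ψ := ψ) hψ ?_ ?_ y (r := r) (h := Nat.clog 2 n)
      (K := Nat.clog 2 (⌊Real.logb 2 (maxDist x)⌋₊ + 1))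
      (fun l hl => (Finset.mem_filter.1 hl).2) (fun l hl => hscale l (hsubL hl))
      ((Finset.card_le_card hsubL).trans hcard)
    · refine h.trans ?_
      have h1 := scales_le_upsilon (x := x) hn hΔ
      -- This lets the additive constants be absorbed into `upsilon x` and explains the factor 2 in
      -- `affectanceConst`.
      have h2 : 1 / 2 ≤ upsilon x := by
        have := half_le_log hn
        unfold upsilon
        linarith [le_max_right (Real.log (Real.log (maxDist x))) 0]
      have h3 : 0 ≤ 4 * β * 2 ^ α * ψ * (farConst α * (1 / 2) ^ (2 - α)) + 2 * β := by
        have := farConst_pos hα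
        positivity
      have h4 : (1 + ε) * (ψ * (4 * (Nat.clog 2 n : ℝ) + 8 +
          (Nat.clog 2 (⌊Real.logb 2 (maxDist x)⌋₊ + 1) : ℝ))) ≤
          (1 + ε) * (ψ * (40 * upsilon x)) := by gcongr
      unfold affectanceConst
      nlinarith
    · intro a ha b hb hab hne'
      have haL := hsubL ha
      have hbL := hsubL hb
      refine (hs a (hmem a haL).1).2.2.2.2 _ (hend a haL) _ ?_ fun h => hne' (congrArg x h)
      -- The endpoint of the link formed later was still active when the round of the earlier one
      -- began, so the spread of that round applies to both endpoints.
      exact initState_active_antitone m A coin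
        (Nat.mul_le_mul_right m (Nat.sub_le_sub_right hab 1)) (hend b hbL)
    · intro z
      refine le_trans ?_ (hdegree f hf z)
      exact_mod_cast Finset.card_le_card (Finset.filter_subset_filter _ hsubL)
  -- Charge the pair to the link of smaller scale; equal scales are counted twice, harmlessly
  -- because the bound is nonnegative.
  have haff : ∀ l ∈ L, ∀ l' ∈ L, affectance α β N ε x (meanPower α K x) l' l ≤
      (if s l ≤ s l' then pairBound α β ε (s l + s l') (dist (x l'.1) (x l.2)) else 0) +
      (if s l' ≤ s l then pairBound α β ε (s l' + s l) (dist (x l.2) (x l'.1)) else 0) := by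
    intro l hl l' hl'
    obtain ⟨-, h1, h2, h3, -⟩ := hs l (hmem l hl).1
    have h := affectance_le_pairBound (α := α) (N := N) (ε := ε) hβ hK hα (hlen l hl) (hlen l' hl')
      (hA _ (hinA _ h2) _ (hinA _ h3) (hne l hl)) h1.le (hs l' (hmem l' hl').1).2.1.le
    have hnn : 0 ≤ pairBound α β ε (s l + s l') (dist (x l'.1) (x l.2)) := by
      unfold pairBound
      split_ifs <;> positivity
    rw [add_comm (s l') (s l), dist_comm (x l.2)]
    refine h.trans ?_
    rcases le_total (s l) (s l') with h' | h'
    · rw [if_pos h']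
      split_ifs <;> linarith
    · rw [if_pos h']
      split_ifs <;> linarith
  have h1 : ∑ l ∈ L, ∑ l' ∈ L,
      (if s l ≤ s l' then pairBound α β ε (s l + s l') (dist (x l'.1) (x l.2)) else 0) ≤
      ∑ l ∈ L, affectanceConst α β ε ψ * upsilon x := by
    refine Finset.sum_le_sum fun l _ => ?_
    rw [← Finset.sum_filter]
    exact hinner Prod.fst (fun _ => Or.inl rfl) (x l.2) (s l)
  have h2 : ∑ l ∈ L, ∑ l' ∈ L,
      (if s l' ≤ s l then pairBound α β ε (s l' + s l) (dist (x l.2) (x l'.1)) else 0) ≤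
      ∑ l ∈ L, affectanceConst α β ε ψ * upsilon x := by
    rw [Finset.sum_comm]
    refine Finset.sum_le_sum fun l' _ => ?_
    rw [← Finset.sum_filter]
    exact hinner Prod.snd (fun _ => Or.inr rfl) (x l'.1) (s l')
  have h3 : totalAffectance α β N ε x (meanPower α K x) L ≤
      ∑ l ∈ L, ∑ l' ∈ L,
        ((if s l ≤ s l' then pairBound α β ε (s l + s l') (dist (x l'.1) (x l.2)) else 0) +
        (if s l' ≤ s l then pairBound α β ε (s l' + s l) (dist (x l.2) (x l'.1)) else 0)) :=
    Finset.sum_le_sum fun l hl => Finset.sum_le_sum fun l' hl' => haff l hl l' hl'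
  simp only [Finset.sum_add_distrib] at h3
  rw [Finset.sum_const, nsmul_eq_mul] at h1 h2
  linarith

/-- With sufficiently many slot-pairs per round, the failure probability is polynomially small. -/
theorem sq_mul_pow_pairsPerRound_le {q c lam : ℝ} (hq : 0 < q) (hq1 : q ≤ 1) (hc : 0 < c)
    (hlam : (c + 2) / q ≤ lam) (n : ℕ) :
    (n : ℝ) ^ 2 * (1 - q) ^ pairsPerRound lam n ≤ 1 / (n : ℝ) ^ c := by
  -- For `n = 0` both sides vanish, the right one because `1 / 0 = 0`.
  rcases Nat.eq_zero_or_pos n with rfl | hn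
  · simp [Real.zero_rpow hc.ne']
  have hn0 : (0 : ℝ) < n := by exact_mod_cast hn
  have hlog : 0 ≤ Real.log n := Real.log_nonneg (by exact_mod_cast hn)
  have hm : lam * Real.log n ≤ pairsPerRound lam n := Nat.le_ceil _
  have h1 : (1 - q) ^ pairsPerRound lam n ≤ Real.exp (-(c + 2) * Real.log n) := by
    calc (1 - q) ^ pairsPerRound lam n ≤ Real.exp (-q) ^ pairsPerRound lam n :=
          pow_le_pow_left₀ (by linarith) (Real.one_sub_le_exp_neg q) _
      _ = Real.exp (pairsPerRound lam n * -q) := by rw [Real.exp_nat_mul]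
      _ ≤ _ := by
          refine Real.exp_le_exp.2 ?_
          have h2 : c + 2 ≤ lam * q := (div_le_iff₀ hq).1 hlam
          have h3 : (c + 2) * Real.log n ≤ lam * q * Real.log n := by gcongr
          have h4 : lam * Real.log n * q ≤ pairsPerRound lam n * q := by gcongr
          linarith
  have h2 : Real.exp (-(c + 2) * Real.log n) = 1 / (n : ℝ) ^ c / (n : ℝ) ^ 2 := by
    rw [mul_comm, ← Real.rpow_def_of_pos hn0, neg_add, Real.rpow_add hn0, Real.rpow_neg hn0.le,
      Real.rpow_neg hn0.le, Real.rpow_two]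
    field_simp
  rw [h2, le_div_iff₀ (by positivity)] at h1
  linarith

end SINR

theorem mainTheorem8 (α β ε p : ℝ) (hα : 2 < α) (hβ : 0 < β) (hε : 0 < ε)
    (hp : 0 < p) (hp' : p ≤ 1 / 2) :
    ∃ γ₁ : ℝ, 0 < γ₁ ∧ ∀ c : ℝ, 0 < c → ∃ lam₀ : ℝ, ∀ lam : ℝ, lam₀ ≤ lam →
      ∀ (n : ℕ) (x : Fin n → SINR.Plane), (∀ u v, u ≠ v → 1 ≤ dist (x u) (x v)) →
      ∀ N K : ℝ, 0 < N → 0 < K →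
      ∀ A : Finset (Fin n),
      (∀ u ∈ A, ∀ v ∈ A, u ≠ v →
        SINR.noiseLoad α β N x (SINR.meanPower α K x) (u, v) < 1 ∧
        SINR.noiseFactor α β N x (SINR.meanPower α K x) (u, v) ≤ 2 * β) →
      ∀ sel : Finset (Fin n) → Fin n, (∀ S : Finset (Fin n), S.Nonempty → sel S ∈ S) →
      ∀ R : ℕ, ⌈Real.logb 2 (SINR.maxDist x)⌉₊ ≤ R →
      ∀ (Ω : Type*) [MeasurableSpace Ω] (μ : MeasureTheory.Measure Ω)
        [MeasureTheory.IsProbabilityMeasure μ] (coin : ℕ × Fin n × Bool → Ω → Bool),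
        SINR.IsIIDCoins μ p coin →
        1 - 1 / (n : ℝ) ^ c ≤ μ.real {ω |
          SINR.totalAffectance α β N ε x (SINR.meanPower α K x)
              (SINR.lowDegreeLinks (160 / p ^ 2)
                (SINR.initTree α β N lam x sel R A fun i => coin i ω)) ≤
            γ₁ * SINR.upsilon x *
              ((SINR.lowDegreeLinks (160 / p ^ 2)
                (SINR.initTree α β N lam x sel R A fun i => coin i ω)).card : ℝ)} := by
  obtain ⟨ρ, hρ⟩ := SINR.exists_isQuietRadius β hα
  have hψ : 0 ≤ 160 / p ^ 2 := by positivity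
  have hq := SINR.successProb_pos hp ρ
  refine ⟨2 * SINR.affectanceConst α β ε (160 / p ^ 2),
    mul_pos two_pos (SINR.affectanceConst_pos hα hβ hε hψ), fun c hc =>
    -- The summand 2 pays for the `n ^ 2` pairs in the union bound.
    ⟨(c + 2) / SINR.successProb p ρ, ?_⟩⟩
  intro lam hlam n x hx N K hN hK A hA sel hsel R _ Ω _ μ _ coin hcoin
  have hprob := SINR.one_sub_le_measureReal_roundsSpread hα hβ hN hp hp' hx hsel hρ hcoin
    (SINR.pairsPerRound lam n) R A
  have hsmall := SINR.sq_mul_pow_pairsPerRound_le hq (SINR.successProb_le_one hp hp' ρ) hc hlam n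
  refine le_trans (by linarith) (hprob.trans (measureReal_mono ?_ (measure_ne_top μ _)))
  intro ω hω
  exact SINR.totalAffectance_le hα hβ hε hK hψ hx (fun u hu v hv huv => (hA u hu v hv huv).2) hsel hω
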